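/- Let $0<\rho<1$, $T>0$ and $\varepsilon>0$. Let $H$ be a separable (infinite-dimensional) Hilbert space and $A$ an unbounded positive self-adjoint operator in $H$ with a complete orthonormal system of eigenvectors $v_k$, $Av_k=\lambda_kv_k$, $0<\lambda_1\le\lambda_2\le\cdots\to+\infty$. For real $\tau$ let $D(A^\tau)=\{g\in H:\ \|g\|_\tau^2:=\sum_{k}\lambda_k^{2\tau}|(g,v_k)|^2<\infty\}$, with norm $\|\cdot\|_\tau$. For $h$ with values in $H$ put $\partial_t^{\rho-1}h(t)=\frac{1}{\Gamma(1-\rho)}\int_0^t (t-\xi)^{-\rho}h(\xi)\,d\xi$ and $\partial_t^\rho h=\frac{d}{dt}\partial_t^{\rho-1}h$ (Riemann--Liouville derivative). A solution of the forward problem $$\partial_t^\rho u(t)+Au(t)=f(t)\quad(0<t<T),\qquad \lim_{t\to0+}\partial_t^{\rho-1}u(t)=\varphi$$ is a function $u\in C((0,T];H)$ with $\partial_t^\rho u,\ Au\in C((0,T);H)$ satisfying both conditions. Suppose that $\varphi\in H$ and $t^{1-\rho}f(t)\in C([0,T];D(A^{1+\varepsilon}))$, that is, $t^{1-\rho}f(t)$,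 $0<t\le T$, extends to a continuous function on $[0,T]$ with values in $D(A^{1+\varepsilon})$. Then the solution $u$ of the forward problem satisfies $u(T)\in D(A^2)$ and $$\|u(T)\|_2\le C\Big(\|\varphi\|+\max_{t\in[0,T]}\|t^{1-\rho}f(t)\|_{1+\varepsilon}\Big).$$ The constant $C$ does not depend on $\varphi$, $f$, $u$. If $\varepsilon<1$, it depends only on $\rho$, $T$ and $\varepsilon$, and not on $H$ or $A$; if $\varepsilon\ge1$, it depends only on $\rho$, $T$, $\varepsilon$ and a positive lower bound $\mu\le\lambda_1$ of the eigenvalues. -/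

import Mathlib

open Filter Topology

noncomputable section

/-- `A` is a positive self-adjoint operator with a complete orthonormal system of eigenvectors
`v k ∈ D(A)`, `A (v k) = lam k • v k`, whose eigenvalues satisfy
`0 < lam 0 ≤ lam 1 ≤ ⋯ → ∞` (so `A` is unbounded and its spectrum is discrete). -/
structure IsPositiveDiscrete {𝕜 H : Type*} [RCLike 𝕜] [NormedAddCommGroup H]
    [InnerProductSpace 𝕜 H] [CompleteSpace H]
    (A : H →ₗ.[𝕜] H) (v : HilbertBasis ℕ 𝕜 H) (lam : ℕ → ℝ) : Prop where
  isSelfAdjoint : IsSelfAdjoint A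
  eigenvector_mem : ∀ k, v k ∈ A.domain
  eigenvector_apply : ∀ k, A ⟨v k, eigenvector_mem k⟩ = (lam k : 𝕜) • v k
  pos : 0 < lam 0
  mono : Monotone lam
  tendsto_atTop : Tendsto lam atTop atTop

/-- The domain of the power `A ^ τ`: those `x` with `∑ k, lam k ^ (2 τ) * |(x, v k)|² < ∞`. -/
def powDomain {𝕜 H : Type*} [RCLike 𝕜] [NormedAddCommGroup H] [InnerProductSpace 𝕜 H]
    (v : HilbertBasis ℕ 𝕜 H) (lam : ℕ → ℝ) (τ : ℝ) : Set H :=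
  {x | Summable fun k => lam k ^ (2 * τ) * ‖inner 𝕜 (v k) x‖ ^ 2}

/-- The norm `‖x‖_τ = ‖A ^ τ x‖` of `D(A ^ τ)` (meaningful for `x` in `powDomain v lam τ`). -/
def powNorm {𝕜 H : Type*} [RCLike 𝕜] [NormedAddCommGroup H] [InnerProductSpace 𝕜 H]
    (v : HilbertBasis ℕ 𝕜 H) (lam : ℕ → ℝ) (τ : ℝ) (x : H) : ℝ :=
  √(∑' k, lam k ^ (2 * τ) * ‖inner 𝕜 (v k) x‖ ^ 2)

/-- `g ∈ C([0, T]; D(A ^ τ))`, where `D(A ^ τ)` carries the norm `powNorm v lam τ`. -/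
structure IsContinuousInPowDomain {𝕜 H : Type*} [RCLike 𝕜] [NormedAddCommGroup H]
    [InnerProductSpace 𝕜 H]
    (v : HilbertBasis ℕ 𝕜 H) (lam : ℕ → ℝ) (τ T : ℝ) (g : ℝ → H) : Prop where
  mem : ∀ t ∈ Set.Icc 0 T, g t ∈ powDomain v lam τ
  continuous : ∀ t₀ ∈ Set.Icc 0 T,
    Tendsto (fun t => powNorm v lam τ (g t - g t₀)) (𝓝[Set.Icc 0 T] t₀) (𝓝 0)

/-- `max_{t ∈ [0, T]} ‖g t‖_τ`. -/
def maxPowNorm {𝕜 H : Type*} [RCLike 𝕜] [NormedAddCommGroup H] [InnerProductSpace 𝕜 H]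
    (v : HilbertBasis ℕ 𝕜 H) (lam : ℕ → ℝ) (τ T : ℝ) (g : ℝ → H) : ℝ :=
  sSup ((fun t => powNorm v lam τ (g t)) '' Set.Icc 0 T)

/-- The fractional integral of order `σ < 0`,
`(∂_t^σ h)(t) = Γ(-σ)⁻¹ ∫_0^t (t - ξ)^(-σ - 1) h(ξ) dξ`. -/
def fracIntegral {H : Type*} [NormedAddCommGroup H] [NormedSpace ℝ H]
    (σ : ℝ) (h : ℝ → H) (t : ℝ) : H :=
  (Real.Gamma (-σ))⁻¹ • ∫ ξ in (0 : ℝ)..t, (t - ξ) ^ (-σ - 1) • h ξ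

/-- The Riemann-Liouville derivative of order `ρ ∈ (0, 1)`: `∂_t^ρ h = d/dt ∂_t^(ρ-1) h`. -/
def rlDeriv {H : Type*} [NormedAddCommGroup H] [NormedSpace ℝ H]
    (ρ : ℝ) (h : ℝ → H) (t : ℝ) : H :=
  deriv (fracIntegral (ρ - 1) h) t

/-- `u` is a solution of the forward problem
`∂_t^ρ u + A u = f` on `(0, T)`, `lim_{t → 0+} ∂_t^(ρ-1) u(t) = φ`:
`u ∈ C((0, T]; H)`, `∂_t^ρ u` and `A u` exist and belong to `C((0, T); H)`,
and both conditions hold. -/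
structure IsForwardSolution {𝕜 H : Type*} [RCLike 𝕜] [NormedAddCommGroup H]
    [InnerProductSpace 𝕜 H] [NormedSpace ℝ H]
    (A : H →ₗ.[𝕜] H) (ρ T : ℝ) (f : ℝ → H) (φ : H) (u : ℝ → H) : Prop where
  continuousOn : ContinuousOn u (Set.Ioc 0 T)
  integrable : ∀ t ∈ Set.Ioo 0 T,
    IntervalIntegrable (fun ξ => (t - ξ) ^ (-(ρ - 1) - 1) • u ξ) MeasureTheory.volume 0 t
  differentiableAt : ∀ t ∈ Set.Ioo 0 T, DifferentiableAt ℝ (fracIntegral (ρ - 1) u) t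
  continuousOn_rlDeriv : ContinuousOn (rlDeriv ρ u) (Set.Ioo 0 T)
  mem_domain : ∀ t ∈ Set.Ioo 0 T, u t ∈ A.domain
  continuous_apply : Continuous fun t : Set.Ioo 0 T => A ⟨u t, mem_domain t t.2⟩
  equation : ∀ (t : ℝ) (ht : t ∈ Set.Ioo 0 T),
    rlDeriv ρ u t + A ⟨u t, mem_domain t ht⟩ = f t
  initial : Tendsto (fracIntegral (ρ - 1) u) (𝓝[>] 0) (𝓝 φ)

end

open MeasureTheory Set intervalIntegral

/-! Write k_a for `powerKernel a`, `*` for convolution on (0, t), and put e = `mlKernel ρ l ρ`, m =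
`mlKernel ρ l 1` with l an eigenvalue. Each coefficient u_k = (v_k, u) solves a scalar fractional
equation, so u_k = e φ_k + e * f_k almost everywhere. The theorem then rests on bounds for e that
are uniform in l: e ≤ C t^(ρ-1) and e ≤ C l^(-2) t^(-1-ρ). At time T the second one absorbs the
factor l² in front of φ_k. Interpolating the two gives l² e(s) ≤ D l^(1+ε) s^(σ-1) with σ = ρ min(ε,
1) > 0 (`exists_sq_mul_mlKernel_le`). This is integrable against the singularity (t-s)^(ρ-1) of f,
so Minkowski's inequality bounds the source term.

The kernel bounds use no complex analysis. The law k_a * k_b = k_(a+b) turns the Mittag-Leffler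
series into Volterra equations: e = k_ρ - l k_ρ * e, m = 1 - l k_ρ * m, m = 1 - l ∫ e. Log-convexity
of k_ρ forces e > 0 (`pos_of_volterra`), so e ≤ k_ρ and m decreases; then 0 ≤ m ≤ Γ(ρ+1) / (l t^ρ).
The identity t e = ρ e * m converts the decay of m into decay of e, and two passes through it
(`mul_mlKernel_le`) gain the factor l^(-2).

The coefficient formula is obtained for an arbitrary solution by convolving the integrated equation
with e, so uniqueness is built in. It holds almost everywhere; continuity of u up to T transfers the
estimate to t = T. -/

theorem MeasureTheory.integrable_tsum_of_summable_integral_norm {α ι : Type*} [Countable ι]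
    [MeasurableSpace α] {ν : Measure α} {F : ι → α → ℝ} (hF : ∀ i, Integrable (F i) ν)
    (hs : Summable fun i => ∫ a, ‖F i a‖ ∂ν)
    (hm : AEStronglyMeasurable (fun a => ∑' i, F i a) ν) :
    Integrable (fun a => ∑' i, F i a) ν := by
  refine ⟨hm, ?_⟩
  calc ∫⁻ a, ‖∑' i, F i a‖ₑ ∂ν ≤ ∫⁻ a, ∑' i, ‖F i a‖ₑ ∂ν :=
        lintegral_mono fun a => enorm_tsum_le_tsum_enorm
    _ = ∑' i, ∫⁻ a, ‖F i a‖ₑ ∂ν := lintegral_tsum fun i => (hF i).1.enorm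
    _ = ∑' i, ENNReal.ofReal (∫ a, ‖F i a‖ ∂ν) := by
        simp_rw [ofReal_integral_norm_eq_lintegral_enorm (hF _)]
    _ < ⊤ := by
        rw [← ENNReal.ofReal_tsum_of_nonneg (fun i => integral_nonneg fun _ => norm_nonneg _) hs]
        exact ENNReal.ofReal_lt_top

/-! ### Power kernels, Mittag-Leffler series and their convolution identities -/

/-- The kernel `t ^ (a - 1) / Γ(a)` of the fractional integral of order `a`. -/
noncomputable def powerKernel (a t : ℝ) : ℝ := t ^ (a - 1) / Real.Gamma a

/-- The solution `t ^ (β - 1) E_{ρ,β}(-λ t ^ ρ)`, where `E_{ρ,β}` is the Mittag-Leffler function. -/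
noncomputable def mlKernel (ρ l β t : ℝ) : ℝ := ∑' n : ℕ, (-l) ^ n * powerKernel (ρ * n + β) t

theorem powerKernel_pos {a t : ℝ} (ha : 0 < a) (ht : 0 < t) : 0 < powerKernel a t := by
  have := Real.Gamma_pos_of_pos ha
  unfold powerKernel; positivity

theorem powerKernel_nonneg {a t : ℝ} (ha : 0 < a) (ht : 0 ≤ t) : 0 ≤ powerKernel a t := by
  have := Real.Gamma_pos_of_pos ha
  unfold powerKernel; positivity

theorem continuousOn_powerKernel {a : ℝ} : ContinuousOn (powerKernel a) (Ioi 0) := fun _ ht =>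
  ((Real.continuousAt_rpow_const _ _ (Or.inl (ne_of_gt ht))).div_const _).continuousWithinAt

theorem powerKernel_one (t : ℝ) : powerKernel 1 t = 1 := by simp [powerKernel]

/-- The Beta integral B(a, b) = Γ(a)Γ(b)/Γ(a+b), rescaled to (0, t): the semigroup law of fractional
integration. -/
theorem integral_powerKernel_mul {a b t : ℝ} (ha : 0 < a) (hb : 0 < b) (ht : 0 < t) :
    ∫ s in (0 : ℝ)..t, powerKernel a s * powerKernel b (t - s) = powerKernel (a + b) t := by
  have h := Complex.betaIntegral_scaled (a : ℂ) (b : ℂ) ht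
  rw [Complex.betaIntegral_eq_Gamma_mul_div _ _ (by simpa) (by simpa)] at h
  have h1 : ∫ s in (0 : ℝ)..t, (s : ℂ) ^ ((a : ℂ) - 1) * ((t : ℂ) - s) ^ ((b : ℂ) - 1)
      = ((∫ s in (0 : ℝ)..t, s ^ (a - 1) * (t - s) ^ (b - 1) : ℝ) : ℂ) := by
    rw [← intervalIntegral.integral_ofReal]
    refine integral_congr fun s hs => ?_
    rw [uIcc_of_le ht.le] at hs
    push_cast
    rw [Complex.ofReal_cpow hs.1, Complex.ofReal_cpow (sub_nonneg.2 hs.2)]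
    push_cast; rfl
  have h2 : ∫ s in (0 : ℝ)..t, s ^ (a - 1) * (t - s) ^ (b - 1)
      = t ^ (a + b - 1) * (Real.Gamma a * Real.Gamma b / Real.Gamma (a + b)) := by
    rw [h1] at h
    rw [← Complex.ofReal_inj, h]
    push_cast
    rw [Complex.ofReal_cpow ht.le, ← Complex.Gamma_ofReal, ← Complex.Gamma_ofReal,
      ← Complex.Gamma_ofReal]
    push_cast; rfl
  have e : ∀ s, powerKernel a s * powerKernel b (t - s)
      = (Real.Gamma a * Real.Gamma b)⁻¹ * (s ^ (a - 1) * (t - s) ^ (b - 1)) := by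
    intro s; unfold powerKernel; ring
  simp_rw [e]
  rw [intervalIntegral.integral_const_mul, h2]
  have := (Real.Gamma_pos_of_pos ha).ne'
  have := (Real.Gamma_pos_of_pos hb).ne'
  unfold powerKernel
  field_simp

theorem intervalIntegrable_powerKernel_mul {a b t : ℝ} (ha : 0 < a) (hb : 0 < b) (ht : 0 < t) :
    IntervalIntegrable (fun s => powerKernel a s * powerKernel b (t - s)) volume 0 t := by
  -- A non-integrable function has integral 0 by convention, whereas the Beta integral is positive.
  by_contra h
  have h1 := integral_powerKernel_mul ha hb ht
  rw [integral_undef h] at h1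
  exact (powerKernel_pos (add_pos ha hb) ht).ne h1

/-- A lower bound for the growth of the Gamma function. -/
theorem rpow_div_le_Gamma {x R : ℝ} (hx : 0 < x) (hR : 0 < R) :
    R ^ x / ((R + 1) * Real.exp (R + 1)) ≤ Real.Gamma x := by
  rw [Real.Gamma_eq_integral hx]
  have h1 : ∫ t in Ioc R (R + 1), R ^ x / ((R + 1) * Real.exp (R + 1))
      = R ^ x / ((R + 1) * Real.exp (R + 1)) := by simp
  rw [← h1]
  have hi := Real.GammaIntegral_convergent hx
  have hsub : Ioc R (R + 1) ⊆ Ioi 0 := fun t ht => hR.trans ht.1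
  calc _ ≤ ∫ t in Ioc R (R + 1), Real.exp (-t) * t ^ (x - 1) := by
        refine setIntegral_mono_on (by simp) (hi.mono_set hsub) measurableSet_Ioc ?_
        intro t ht
        have ht0 : 0 < t := hR.trans ht.1
        rw [Real.rpow_sub_one ht0.ne', Real.exp_neg, div_eq_inv_mul, mul_inv]
        have : R ^ x ≤ t ^ x := Real.rpow_le_rpow hR.le ht.1.le hx.le
        have h2 : (R + 1)⁻¹ ≤ t⁻¹ := inv_anti₀ ht0 ht.2
        have h3 : (Real.exp (R + 1))⁻¹ ≤ (Real.exp t)⁻¹ :=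
          inv_anti₀ (Real.exp_pos _) (Real.exp_le_exp.2 ht.2)
        calc (R + 1)⁻¹ * (Real.exp (R + 1))⁻¹ * R ^ x ≤ t⁻¹ * (Real.exp t)⁻¹ * t ^ x := by gcongr
          _ = _ := by ring
    _ ≤ _ := by
        refine setIntegral_mono_set hi ?_ hsub.eventuallyLE
        refine (ae_restrict_iff' measurableSet_Ioi).2 (ae_of_all _ fun t ht => ?_)
        have : 0 < t := ht
        simp only [Pi.zero_apply]; positivity

theorem summable_pow_div_Gamma {ρ β : ℝ} (hρ : 0 < ρ) (hβ : 0 < β) {z : ℝ} (hz : 0 ≤ z) :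
    Summable fun n : ℕ => z ^ n / Real.Gamma (ρ * n + β) := by
  -- Since R^ρ = z + 1, the bound Γ(x) ≥ c R^x makes the series geometric with ratio z/(z+1) < 1.
  set R : ℝ := (z + 1) ^ ρ⁻¹
  have hR : 0 < R := by positivity
  have hRρ : R ^ ρ = z + 1 := by
    rw [← Real.rpow_mul (by positivity), inv_mul_cancel₀ hρ.ne', Real.rpow_one]
  have hg : Summable fun n : ℕ => ((R + 1) * Real.exp (R + 1)) / R ^ β * (z / (z + 1)) ^ n :=
    (summable_geometric_of_lt_one (by positivity) (by rw [div_lt_one] <;> linarith)).mul_left _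
  refine Summable.of_nonneg_of_le (fun n => ?_) (fun n => ?_) hg
  · have := Real.Gamma_pos_of_pos (show 0 < ρ * n + β by positivity)
    positivity
  · have hx : 0 < ρ * n + β := by positivity
    have h := rpow_div_le_Gamma hx hR
    have h0 : 0 < R ^ (ρ * n + β) / ((R + 1) * Real.exp (R + 1)) := by positivity
    calc z ^ n / Real.Gamma (ρ * n + β)
        ≤ z ^ n / (R ^ (ρ * n + β) / ((R + 1) * Real.exp (R + 1))) := by gcongr
      _ = _ := by
        rw [Real.rpow_add hR, Real.rpow_mul hR.le, hRρ, Real.rpow_natCast, div_pow]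
        field_simp

theorem powerKernel_add_mul {ρ β t : ℝ} (ht : 0 < t) (n : ℕ) :
    powerKernel (ρ * n + β) t = t ^ (β - 1) * ((t ^ ρ) ^ n / Real.Gamma (ρ * n + β)) := by
  unfold powerKernel
  rw [add_sub_assoc, Real.rpow_add ht, Real.rpow_mul ht.le, Real.rpow_natCast]; ring

theorem summable_pow_mul_powerKernel {ρ β l t : ℝ} (hρ : 0 < ρ) (hβ : 0 < β) (hl : 0 ≤ l)
    (ht : 0 < t) : Summable fun n : ℕ => l ^ n * powerKernel (ρ * n + β) t := by
  have := (summable_pow_div_Gamma hρ hβ (show 0 ≤ l * t ^ ρ by positivity)).mul_left (t ^ (β - 1))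
  refine this.congr fun n => ?_
  rw [powerKernel_add_mul ht, mul_pow]; ring

theorem norm_neg_pow_mul_powerKernel {ρ β l t : ℝ} (hρ : 0 < ρ) (hβ : 0 < β) (hl : 0 ≤ l)
    (ht : 0 ≤ t) (n : ℕ) : ‖(-l) ^ n * powerKernel (ρ * n + β) t‖
      = l ^ n * powerKernel (ρ * n + β) t := by
  rw [norm_mul, norm_pow, norm_neg, Real.norm_of_nonneg hl,
    Real.norm_of_nonneg (powerKernel_nonneg (by positivity) ht)]

theorem summable_norm_mlKernel {ρ β l t : ℝ} (hρ : 0 < ρ) (hβ : 0 < β) (hl : 0 ≤ l)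
    (ht : 0 < t) : Summable fun n : ℕ => ‖(-l) ^ n * powerKernel (ρ * n + β) t‖ := by
  simp_rw [norm_neg_pow_mul_powerKernel hρ hβ hl ht.le]
  exact summable_pow_mul_powerKernel hρ hβ hl ht

/-- Splits off the term n = 0. With termwise convolution this becomes the Volterra equation of the
kernel. -/
theorem mlKernel_eq_sub {ρ β l t : ℝ} (hρ : 0 < ρ) (hβ : 0 < β) (hl : 0 ≤ l) (ht : 0 < t) :
    mlKernel ρ l β t = powerKernel β t - l * mlKernel ρ l (ρ + β) t := by
  have h := (summable_norm_mlKernel hρ hβ hl ht).of_norm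
  unfold mlKernel
  rw [h.tsum_eq_zero_add, ← tsum_mul_left, sub_eq_add_neg, ← tsum_neg]
  congr 1
  · simp
  · refine tsum_congr fun n => ?_
    rw [pow_succ]; push_cast
    rw [show ρ * (n + 1 : ℝ) + β = ρ * n + (ρ + β) by ring]; ring

theorem continuousOn_mlKernel {ρ β l : ℝ} (hρ : 0 < ρ) (hβ : 0 < β) (hl : 0 ≤ l) :
    ContinuousOn (mlKernel ρ l β) (Ioi 0) := by
  have h1 : ContinuousOn (fun t : ℝ => t ^ (β - 1) *
      ∑' n : ℕ, (-l * t ^ ρ) ^ n / Real.Gamma (ρ * n + β)) (Ioi 0) := by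
    refine ContinuousOn.mul (fun t ht => (Real.continuousAt_rpow_const _ _
      (Or.inl (ne_of_gt ht))).continuousWithinAt) ?_
    intro t ht
    have ht : 0 < t := ht
    have : ContinuousOn (fun t : ℝ => ∑' n : ℕ, (-l * t ^ ρ) ^ n / Real.Gamma (ρ * n + β))
        (Icc 0 (t + 1)) := by
      refine continuousOn_tsum (u := fun n : ℕ => (l * (t + 1) ^ ρ) ^ n / Real.Gamma (ρ * n + β))
        (fun n => ?_) (summable_pow_div_Gamma hρ hβ (by positivity)) ?_
      · have : Continuous fun t : ℝ => t ^ ρ := Real.continuous_rpow_const hρ.le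
        fun_prop
      · intro n s hs
        have hG := Real.Gamma_pos_of_pos (show 0 < ρ * n + β by positivity)
        rw [norm_div, Real.norm_of_nonneg hG.le, norm_pow, norm_mul, norm_neg,
          Real.norm_of_nonneg hl, Real.norm_of_nonneg (Real.rpow_nonneg hs.1 _)]
        have : s ^ ρ ≤ (t + 1) ^ ρ := Real.rpow_le_rpow hs.1 hs.2 hρ.le
        have := Real.rpow_nonneg hs.1 ρ
        gcongr
    exact (this.continuousAt (Icc_mem_nhds ht (by linarith))).continuousWithinAt
  refine h1.congr fun t ht => ?_
  have ht : 0 < t := ht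
  simp only [mlKernel]
  rw [← tsum_mul_left]
  refine tsum_congr fun n => ?_
  rw [powerKernel_add_mul ht, mul_pow]; ring

/-- Termwise integration of a convolution with a series of power kernels. -/
theorem integral_powerKernel_mul_mlKernel {ρ β l a t : ℝ} (hρ : 0 < ρ) (hβ : 0 < β) (hl : 0 ≤ l)
    (ha : 0 < a) (ht : 0 < t) :
    IntervalIntegrable (fun s => powerKernel a s * mlKernel ρ l β (t - s)) volume 0 t ∧
    ∫ s in (0 : ℝ)..t, powerKernel a s * mlKernel ρ l β (t - s) = mlKernel ρ l (a + β) t := by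
  have hb : ∀ n : ℕ, 0 < ρ * n + β := fun n => by positivity
  set F : ℕ → ℝ → ℝ := fun n s => (-l) ^ n * (powerKernel a s * powerKernel (ρ * n + β) (t - s))
  have hF : ∀ n, Integrable (F n) (volume.restrict (Ioc 0 t)) := fun n =>
    ((intervalIntegrable_iff_integrableOn_Ioc_of_le ht.le).1
      (intervalIntegrable_powerKernel_mul ha (hb n) ht)).const_mul _
  have hnorm : ∀ n, ∫ s in Ioc 0 t, ‖F n s‖ = l ^ n * powerKernel (ρ * n + (a + β)) t := by
    intro n
    rw [show ρ * n + (a + β) = a + (ρ * n + β) by ring, ← integral_powerKernel_mul ha (hb n) ht,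
      integral_of_le ht.le, ← MeasureTheory.integral_const_mul]
    refine setIntegral_congr_fun measurableSet_Ioc fun s hs => ?_
    simp only [F]
    rw [norm_mul, norm_pow, norm_neg, Real.norm_of_nonneg hl, Real.norm_of_nonneg]
    exact mul_nonneg (powerKernel_nonneg ha hs.1.le)
      (powerKernel_nonneg (hb n) (sub_nonneg.2 hs.2))
  have hs : Summable fun n => ∫ s in Ioc 0 t, ‖F n s‖ := by
    simp_rw [hnorm]
    exact summable_pow_mul_powerKernel hρ (by positivity) hl ht
  have htsum : ∀ s, ∑' n, F n s = powerKernel a s * mlKernel ρ l β (t - s) := by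
    intro s
    simp only [F, mlKernel]
    rw [← tsum_mul_left]
    exact tsum_congr fun n => by ring
  constructor
  · rw [intervalIntegrable_iff_integrableOn_Ioc_of_le ht.le]
    have hm : AEStronglyMeasurable (fun s => ∑' n, F n s) (volume.restrict (Ioc 0 t)) := by
      simp_rw [htsum, ← restrict_Ioo_eq_restrict_Ioc]
      exact ((continuousOn_powerKernel.mono fun s hs => hs.1).mul
        ((continuousOn_mlKernel hρ hβ hl).comp (by fun_prop) fun s hs =>
          sub_pos.2 hs.2)).aestronglyMeasurable measurableSet_Ioo
    simp_rw [← htsum]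
    exact integrable_tsum_of_summable_integral_norm hF hs hm
  · have h := (hasSum_integral_of_summable_integral_norm hF hs).tsum_eq
    simp_rw [htsum] at h
    rw [integral_of_le ht.le, ← h]
    unfold mlKernel
    refine tsum_congr fun n => ?_
    rw [MeasureTheory.integral_const_mul, ← integral_of_le ht.le,
      integral_powerKernel_mul ha (hb n) ht,
      show ρ * n + (a + β) = a + (ρ * n + β) by ring]

/-- `t e(t) = ρ (e * m)(t)` for `e = mlKernel ρ l ρ` and `m = mlKernel ρ l 1`. -/
theorem integral_mlKernel_mul_mlKernel_one {ρ l t : ℝ} (hρ : 0 < ρ) (hl : 0 ≤ l) (ht : 0 < t) :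
    IntervalIntegrable (fun s => mlKernel ρ l ρ s * mlKernel ρ l 1 (t - s)) volume 0 t ∧
    ρ * ∫ s in (0 : ℝ)..t, mlKernel ρ l ρ s * mlKernel ρ l 1 (t - s) = t * mlKernel ρ l ρ t := by
  have hb : ∀ n : ℕ, 0 < ρ * n + ρ := fun n => by positivity
  have hc : ∀ n : ℕ, 0 < ρ * n + 1 := fun n => by positivity
  set F : ℕ → ℝ → ℝ := fun n s => ∑ p ∈ Finset.HasAntidiagonal.antidiagonal n,
    ((-l) ^ p.1 * powerKernel (ρ * p.1 + ρ) s) * ((-l) ^ p.2 * powerKernel (ρ * p.2 + 1) (t - s))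
  set G : ℕ → ℝ → ℝ := fun n s => ∑ p ∈ Finset.HasAntidiagonal.antidiagonal n,
    l ^ n * (powerKernel (ρ * p.1 + ρ) s * powerKernel (ρ * p.2 + 1) (t - s))
  -- `F n` is the n-th term of the Cauchy product. Its summands share the sign (-1)^n, so its norm
  -- on (0, t) is exactly `G n`.
  have hFG : ∀ n s, F n s = (-1) ^ n * G n s := by
    intro n s
    simp only [F, G]
    rw [Finset.mul_sum]
    refine Finset.sum_congr rfl fun p hp => ?_
    rw [← Finset.HasAntidiagonal.mem_antidiagonal.1 hp, neg_pow l p.1, neg_pow l p.2, pow_add, pow_add]; ring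
  have hI : ∀ p : ℕ × ℕ, Integrable (fun s => powerKernel (ρ * p.1 + ρ) s *
      powerKernel (ρ * p.2 + 1) (t - s)) (volume.restrict (Ioc 0 t)) := fun p =>
    (intervalIntegrable_iff_integrableOn_Ioc_of_le ht.le).1
      (intervalIntegrable_powerKernel_mul (hb _) (hc _) ht)
  have hGi : ∀ n, Integrable (G n) (volume.restrict (Ioc 0 t)) := fun n =>
    integrable_finsetSum _ fun p _ => (hI p).const_mul _
  have hFi : ∀ n, Integrable (F n) (volume.restrict (Ioc 0 t)) := fun n => by
    rw [show F n = fun s => (-1) ^ n * G n s from funext (hFG n)]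
    exact (hGi n).const_mul _
  -- By the semigroup law all n + 1 summands have the same integral, and Γ(ρ(n+1)+1) =
  -- ρ(n+1)Γ(ρ(n+1)) absorbs their number. This is the source of the factor t/ρ.
  have hGint : ∀ n, ∫ s in Ioc 0 t, G n s = l ^ n * (t / ρ * powerKernel (ρ * n + ρ) t) := by
    intro n
    simp only [G]
    rw [integral_finsetSum _ fun p _ => (hI p).const_mul _]
    have : ∀ p ∈ Finset.HasAntidiagonal.antidiagonal n, ∫ s in Ioc 0 t, l ^ n * (powerKernel (ρ * p.1 + ρ) s *
        powerKernel (ρ * p.2 + 1) (t - s)) = l ^ n * powerKernel (ρ * n + ρ + 1) t := by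
      intro p hp
      rw [MeasureTheory.integral_const_mul, ← integral_of_le ht.le,
        integral_powerKernel_mul (hb _) (hc _) ht, ← Finset.HasAntidiagonal.mem_antidiagonal.1 hp]
      push_cast; congr 2; ring
    rw [Finset.sum_congr rfl this, Finset.sum_const, Finset.Nat.card_antidiagonal, nsmul_eq_mul]
    unfold powerKernel
    rw [Real.Gamma_add_one (hb n).ne', add_sub_cancel_right, Real.rpow_sub_one ht.ne']
    have := (Real.Gamma_pos_of_pos (hb n)).ne'
    have := (hb n).ne'
    push_cast
    field_simp
  have hnorm : ∀ n, ∫ s in Ioc 0 t, ‖F n s‖ = l ^ n * (t / ρ * powerKernel (ρ * n + ρ) t) := by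
    intro n
    rw [← hGint]
    refine setIntegral_congr_fun measurableSet_Ioc fun s hs => ?_
    simp only [hFG]
    rw [norm_mul, norm_pow, norm_neg, norm_one, one_pow, one_mul, Real.norm_of_nonneg]
    refine Finset.sum_nonneg fun p _ => ?_
    have := powerKernel_nonneg (hb p.1) hs.1.le
    have := powerKernel_nonneg (hc p.2) (sub_nonneg.2 hs.2)
    positivity
  have hs : Summable fun n => ∫ s in Ioc 0 t, ‖F n s‖ := by
    simp_rw [hnorm]
    refine ((summable_pow_mul_powerKernel hρ hρ hl ht).mul_left (t / ρ)).congr fun n => ?_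
    ring
  have htsum : ∀ s ∈ Ioo 0 t, ∑' n, F n s = mlKernel ρ l ρ s * mlKernel ρ l 1 (t - s) := by
    intro s hs
    simp only [F, mlKernel]
    exact (tsum_mul_tsum_eq_tsum_sum_antidiagonal_of_summable_norm
      (summable_norm_mlKernel hρ hρ hl hs.1)
      (summable_norm_mlKernel hρ one_pos hl (sub_pos.2 hs.2))).symm
  have hae : (fun s => ∑' n, F n s) =ᵐ[volume.restrict (Ioc 0 t)]
      fun s => mlKernel ρ l ρ s * mlKernel ρ l 1 (t - s) := by
    rw [← restrict_Ioo_eq_restrict_Ioc]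
    exact (ae_restrict_iff' measurableSet_Ioo).2 (ae_of_all _ htsum)
  constructor
  · rw [intervalIntegrable_iff_integrableOn_Ioc_of_le ht.le]
    have hm : AEStronglyMeasurable (fun s => mlKernel ρ l ρ s * mlKernel ρ l 1 (t - s))
        (volume.restrict (Ioc 0 t)) := by
      rw [← restrict_Ioo_eq_restrict_Ioc]
      exact (((continuousOn_mlKernel hρ hρ hl).mono fun s hs => hs.1).mul
        ((continuousOn_mlKernel hρ one_pos hl).comp (by fun_prop) fun s hs =>
          sub_pos.2 hs.2)).aestronglyMeasurable measurableSet_Ioo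
    exact (integrable_tsum_of_summable_integral_norm hFi hs (hm.congr hae.symm)).congr hae
  · rw [integral_of_le ht.le, ← integral_congr_ae hae,
      ← (hasSum_integral_of_summable_integral_norm hFi hs).tsum_eq]
    unfold mlKernel
    rw [← tsum_mul_left, ← tsum_mul_left]
    refine tsum_congr fun n => ?_
    simp_rw [hFG]
    rw [MeasureTheory.integral_const_mul, hGint, neg_pow l n]
    field_simp

theorem integral_powerKernel {a t : ℝ} (ha : 0 < a) (ht : 0 < t) :
    IntervalIntegrable (powerKernel a) volume 0 t ∧
    ∫ s in (0 : ℝ)..t, powerKernel a s = powerKernel (a + 1) t := by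
  have h := integral_powerKernel_mul ha one_pos ht
  have h' := intervalIntegrable_powerKernel_mul ha one_pos ht
  simp only [powerKernel_one, mul_one] at h h'
  exact ⟨h', h⟩

/-! ### Positivity of the kernel from log-convexity -/

/-- Near 0 the leading term t^(ρ-1)/Γ(ρ) dominates the remainder, which is O(t^(2ρ-1)). This starts
the first-zero argument, for which the singular point 0 itself is unusable. -/
theorem exists_mlKernel_pos_near_zero {ρ l : ℝ} (hρ : 0 < ρ) (hl : 0 ≤ l) :
    ∃ δ > 0, ∀ t ∈ Ioo 0 δ, 0 < mlKernel ρ l ρ t := by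
  set S : ℝ := ∑' n : ℕ, l ^ n / Real.Gamma (ρ * n + (ρ + ρ))
  have hG := Real.Gamma_pos_of_pos hρ
  have hlim : Tendsto (fun t : ℝ => l * S * t ^ ρ) (𝓝 0) (𝓝 (l * S * 0 ^ ρ)) :=
    ((Real.continuous_rpow_const hρ.le).tendsto 0).const_mul _
  rw [Real.zero_rpow hρ.ne', mul_zero] at hlim
  have hev := (hlim.eventually_lt_const (inv_pos.2 hG)).and
    (eventually_lt_nhds (zero_lt_one' ℝ))
  obtain ⟨δ, hδ, h⟩ := Metric.eventually_nhds_iff.1 hev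
  refine ⟨δ, hδ, fun t ht => ?_⟩
  have ht0 : 0 < t := ht.1
  obtain ⟨h1, h2⟩ := h (y := t) (by rw [Real.dist_eq, sub_zero, abs_of_pos ht0]; exact ht.2)
  have hS : mlKernel ρ l (ρ + ρ) t ≤ t ^ (ρ + ρ - 1) * S := by
    have hρρ : 0 < ρ + ρ := by positivity
    have hsum := summable_norm_mlKernel hρ hρρ hl ht0
    calc mlKernel ρ l (ρ + ρ) t ≤ ∑' n : ℕ, ‖(-l) ^ n * powerKernel (ρ * n + (ρ + ρ)) t‖ :=
          (le_abs_self _).trans (norm_tsum_le_tsum_norm hsum)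
      _ ≤ ∑' n : ℕ, t ^ (ρ + ρ - 1) * (l ^ n / Real.Gamma (ρ * n + (ρ + ρ))) := by
          refine hsum.tsum_le_tsum (fun n => ?_) ((summable_pow_div_Gamma hρ hρρ hl).mul_left _)
          rw [norm_neg_pow_mul_powerKernel hρ hρρ hl ht0.le, powerKernel_add_mul ht0]
          have hx := Real.Gamma_pos_of_pos (show 0 < ρ * n + (ρ + ρ) by positivity)
          have : (t ^ ρ) ^ n ≤ 1 :=
            pow_le_one₀ (by positivity) (Real.rpow_le_one ht0.le h2.le hρ.le)
          calc l ^ n * (t ^ (ρ + ρ - 1) * ((t ^ ρ) ^ n / Real.Gamma (ρ * n + (ρ + ρ))))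
              ≤ l ^ n * (t ^ (ρ + ρ - 1) * (1 / Real.Gamma (ρ * n + (ρ + ρ)))) := by gcongr
            _ = _ := by ring
      _ = _ := tsum_mul_left
  rw [mlKernel_eq_sub hρ hρ hl ht0]
  have : l * mlKernel ρ l (ρ + ρ) t < powerKernel ρ t := by
    calc l * mlKernel ρ l (ρ + ρ) t ≤ l * (t ^ (ρ + ρ - 1) * S) := by gcongr
      _ = t ^ (ρ - 1) * (l * S * t ^ ρ) := by
          rw [show ρ + ρ - 1 = (ρ - 1) + ρ by ring, Real.rpow_add ht0]; ring
      _ < t ^ (ρ - 1) * (Real.Gamma ρ)⁻¹ := by gcongr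
      _ = _ := by unfold powerKernel; ring
  linarith

theorem powerKernel_antitone {ρ x y : ℝ} (hρ : 0 < ρ) (hρ1 : ρ ≤ 1) (hx : 0 < x) (hxy : x ≤ y) :
    powerKernel ρ y ≤ powerKernel ρ x := by
  unfold powerKernel
  have := Real.Gamma_pos_of_pos hρ
  exact div_le_div_of_nonneg_right (Real.rpow_le_rpow_of_nonpos hx hxy (by linarith)) this.le

/-- Log-convexity of the power kernel. -/
theorem powerKernel_sub_mul_le {ρ s t t₀ : ℝ} (hρ : 0 < ρ) (hρ1 : ρ ≤ 1) (hs : 0 ≤ s) (hst : s < t)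
    (ht : t ≤ t₀) :
    powerKernel ρ (t₀ - s) * powerKernel ρ t ≤ powerKernel ρ t₀ * powerKernel ρ (t - s) := by
  have hG := Real.Gamma_pos_of_pos hρ
  have ht0 : 0 < t := hs.trans_lt hst
  unfold powerKernel
  rw [div_mul_div_comm, div_mul_div_comm]
  refine div_le_div_of_nonneg_right ?_ (by positivity)
  rw [← Real.mul_rpow (by linarith) ht0.le, ← Real.mul_rpow (by linarith) (by linarith)]
  exact Real.rpow_le_rpow_of_nonpos (mul_pos (by linarith) (by linarith)) (by nlinarith)
    (by linarith)

theorem intervalIntegrable_comp_reflect {h : ℝ → ℝ} {t : ℝ} (hi : IntervalIntegrable h volume 0 t) :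
    IntervalIntegrable (fun s => h (t - s)) volume 0 t := by
  have := hi.comp_sub_left t
  simpa using this.symm

theorem integral_comp_reflect (h : ℝ → ℝ) (t : ℝ) :
    ∫ s in (0 : ℝ)..t, h (t - s) = ∫ s in (0 : ℝ)..t, h s := by
  rw [integral_comp_sub_left]; simp

/-- The resolvent of a log-convex kernel is positive. -/
theorem pos_of_volterra {ρ l : ℝ} (hρ : 0 < ρ) (hρ1 : ρ ≤ 1) (hl : 0 ≤ l) {e : ℝ → ℝ}
    (hcont : ContinuousOn e (Ioi 0))
    (hint : ∀ t > 0, IntervalIntegrable (fun s => powerKernel ρ (t - s) * e s) volume 0 t)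
    (heq : ∀ t > 0, e t = powerKernel ρ t - l * ∫ s in (0 : ℝ)..t, powerKernel ρ (t - s) * e s)
    (hnear : ∃ δ > 0, ∀ t ∈ Ioo 0 δ, 0 < e t) {t : ℝ} (ht : 0 < t) : 0 < e t := by
  by_contra hneg
  obtain ⟨δ, hδ, hpos⟩ := hnear
  have hδt : δ ≤ t := by
    by_contra h
    exact hneg (hpos t ⟨ht, not_le.1 h⟩)
  have hsubset : Icc (δ / 2) t ⊆ Ioi 0 := fun x hx => lt_of_lt_of_le (half_pos hδ) hx.1
  have hZ : IsCompact {x ∈ Icc (δ / 2) t | e x ≤ 0} :=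
    isCompact_Icc.of_isClosed_subset
      ((hcont.mono hsubset).preimage_isClosed_of_isClosed isClosed_Icc isClosed_Iic) (sep_subset _ _)
  obtain ⟨t₀, ⟨ht₀, he₀⟩, hmin⟩ := hZ.exists_isLeast ⟨t, ⟨by linarith, le_rfl⟩, not_lt.1 hneg⟩
  have ht₀0 : 0 < t₀ := hsubset ht₀
  have hbelow : ∀ x ∈ Ioo 0 t₀, 0 < e x := by
    intro x hx
    by_contra hc
    rcases lt_or_ge x δ with h | h
    · exact hc (hpos x ⟨hx.1, h⟩)
    · exact absurd (hmin ⟨⟨by linarith, by linarith [ht₀.2, hx.2]⟩, not_lt.1 hc⟩) (not_le.2 hx.2)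
  have hlim : Tendsto (fun x => l * powerKernel (ρ + 1) (t₀ - x)) (𝓝 t₀) (𝓝 0) := by
    have : ContinuousAt (fun x => l * powerKernel (ρ + 1) (t₀ - x)) t₀ := by
      unfold powerKernel
      simp only [add_sub_cancel_right]
      have : Continuous fun y : ℝ => y ^ ρ := Real.continuous_rpow_const hρ.le
      fun_prop
    simpa [ContinuousAt, powerKernel, Real.zero_rpow hρ.ne'] using this
  obtain ⟨η, hη, hηl⟩ := Metric.eventually_nhds_iff.1
    (hlim.eventually_lt_const (show (0 : ℝ) < 1 / 2 by norm_num))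
  -- Here t₀ is the first point with e ≤ 0. Points x ≥ t₀/2 satisfy k_ρ(t₀)/k_ρ(x) ≥ 1/2, and points
  -- within η/2 of t₀ satisfy l k_(ρ+1)(t₀ - x) < 1/2. The argument compares t₀ with a maximum point
  -- x of e on [a, t₀].
  set a := max (t₀ / 2) (t₀ - η / 2)
  have ha : a < t₀ := max_lt (by linarith) (by linarith)
  have ha0 : 0 < a := lt_of_lt_of_le (by linarith) (le_max_left _ _)
  obtain ⟨x, hx, hmax⟩ := isCompact_Icc.exists_isMaxOn (nonempty_Icc.2 ha.le)
    (hcont.mono fun y (hy : y ∈ Icc a t₀) => ha0.trans_le hy.1)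
  have hex : 0 < e x := (hbelow a ⟨ha0, ha⟩).trans_le (hmax (left_mem_Icc.2 ha.le))
  have hxt : x < t₀ := by
    refine lt_of_le_of_ne hx.2 fun h => ?_
    rw [h] at hex; exact he₀.not_gt hex
  have hx0 : 0 < x := ha0.trans_le hx.1
  have hkx := powerKernel_pos hρ hx0
  have hk₀ := powerKernel_pos hρ ht₀0
  have hi1 : IntervalIntegrable (fun s => powerKernel ρ (t₀ - s) * e s) volume 0 x :=
    (hint t₀ ht₀0).mono_set (by
      rw [uIcc_of_le hx0.le, uIcc_of_le ht₀0.le]; exact Icc_subset_Icc_right hxt.le)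
  have hi2 : IntervalIntegrable (fun s => powerKernel ρ (t₀ - s) * e s) volume x t₀ :=
    (hint t₀ ht₀0).mono_set (by
      rw [uIcc_of_le hxt.le, uIcc_of_le ht₀0.le]; exact Icc_subset_Icc_left hx0.le)
  -- Log-convexity bounds the history of t₀ before x by a multiple of the history of x, which the
  -- Volterra equation at x evaluates.
  have hfirst : ∫ s in (0 : ℝ)..x, powerKernel ρ (t₀ - s) * e s ≤
      powerKernel ρ t₀ / powerKernel ρ x * ∫ s in (0 : ℝ)..x, powerKernel ρ (x - s) * e s := by
    rw [← intervalIntegral.integral_const_mul]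
    refine integral_mono_on_of_le_Ioo hx0.le hi1 ((hint x hx0).const_mul _) fun s hs => ?_
    have h := powerKernel_sub_mul_le hρ hρ1 hs.1.le hs.2 hxt.le
    have hes := hbelow s ⟨hs.1, hs.2.trans hxt⟩
    rw [← mul_assoc]
    refine mul_le_mul_of_nonneg_right ?_ hes.le
    rw [div_mul_eq_mul_div, le_div_iff₀ hkx]; exact h
  have hshift : ∫ s in x..t₀, powerKernel ρ (t₀ - s) = powerKernel (ρ + 1) (t₀ - x) := by
    rw [integral_comp_sub_left (fun s => powerKernel ρ s), sub_self,
      (integral_powerKernel hρ (sub_pos.2 hxt)).2]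
  have hishift : IntervalIntegrable (fun s => powerKernel ρ (t₀ - s)) volume x t₀ := by
    have := ((integral_powerKernel hρ (sub_pos.2 hxt)).1.comp_sub_left t₀).symm
    simpa using this
  have hsecond : ∫ s in x..t₀, powerKernel ρ (t₀ - s) * e s ≤
      powerKernel (ρ + 1) (t₀ - x) * e x := by
    rw [← hshift, ← intervalIntegral.integral_mul_const]
    refine integral_mono_on hxt.le hi2 (hishift.mul_const _) fun s hs => ?_
    exact mul_le_mul_of_nonneg_left (hmax ⟨hx.1.trans hs.1, hs.2⟩)
      (powerKernel_nonneg hρ (sub_nonneg.2 hs.2))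
  have hE₀ := heq t₀ ht₀0
  have hEx := heq x hx0
  rw [← integral_add_adjacent_intervals hi1 hi2] at hE₀
  set I := ∫ s in (0 : ℝ)..x, powerKernel ρ (x - s) * e s
  have hlI : l * I = powerKernel ρ x - e x := by linarith
  have hratio : 1 / 2 ≤ powerKernel ρ t₀ / powerKernel ρ x := by
    have hG := Real.Gamma_pos_of_pos hρ
    rw [le_div_iff₀ hkx]
    have h1 : powerKernel ρ x ≤ powerKernel ρ (t₀ / 2) :=
      powerKernel_antitone hρ hρ1 (by linarith) ((le_max_left _ _).trans hx.1)
    have h2 : powerKernel ρ (t₀ / 2) = 2 ^ (1 - ρ) * powerKernel ρ t₀ := by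
      unfold powerKernel
      rw [Real.div_rpow ht₀0.le (by norm_num), show (1 - ρ) = -(ρ - 1) by ring,
        Real.rpow_neg (by norm_num)]
      field_simp
    have h3 : (2 : ℝ) ^ (1 - ρ) ≤ 2 := by
      calc (2 : ℝ) ^ (1 - ρ) ≤ 2 ^ (1 : ℝ) :=
            Real.rpow_le_rpow_of_exponent_le (by norm_num) (by linarith)
        _ = 2 := Real.rpow_one 2
    nlinarith
  have hsmall : l * powerKernel (ρ + 1) (t₀ - x) < 1 / 2 := by
    refine hηl ?_
    rw [Real.dist_eq, abs_sub_comm, abs_of_nonneg (by linarith)]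
    have : t₀ - η / 2 ≤ x := (le_max_right _ _).trans hx.1
    linarith
  have h1 : l * (∫ s in (0 : ℝ)..x, powerKernel ρ (t₀ - s) * e s) ≤
      powerKernel ρ t₀ - powerKernel ρ t₀ / powerKernel ρ x * e x := by
    calc _ ≤ l * (powerKernel ρ t₀ / powerKernel ρ x * I) := by gcongr
      _ = powerKernel ρ t₀ / powerKernel ρ x * (l * I) := by ring
      _ = _ := by rw [hlI]; field_simp
  have h2 : l * (∫ s in x..t₀, powerKernel ρ (t₀ - s) * e s) ≤
      l * powerKernel (ρ + 1) (t₀ - x) * e x := by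
    rw [mul_assoc]; gcongr
  -- Altogether e(t₀) ≥ (k_ρ(t₀)/k_ρ(x) - l k_(ρ+1)(t₀ - x)) e(x) > 0, a contradiction.
  nlinarith

/-! ### Monotonicity and decay of the kernels, uniform in the spectral parameter -/

section bounds

variable {ρ l t : ℝ}

theorem mlKernel_pos (hρ : 0 < ρ) (hρ1 : ρ ≤ 1) (hl : 0 ≤ l) (ht : 0 < t) :
    0 < mlKernel ρ l ρ t := by
  refine pos_of_volterra hρ hρ1 hl (continuousOn_mlKernel hρ hρ hl) (fun t ht => ?_)
    (fun t ht => ?_) (exists_mlKernel_pos_near_zero hρ hl) ht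
  · have := intervalIntegrable_comp_reflect (integral_powerKernel_mul_mlKernel hρ hρ hl hρ ht).1
    simpa using this
  · rw [← integral_comp_reflect]
    simp only [sub_sub_cancel]
    rw [(integral_powerKernel_mul_mlKernel hρ hρ hl hρ ht).2]
    exact mlKernel_eq_sub hρ hρ hl ht

theorem intervalIntegrable_mlKernel {β : ℝ} (hρ : 0 < ρ) (hβ : 0 < β) (hl : 0 ≤ l) (ht : 0 < t) :
    IntervalIntegrable (mlKernel ρ l β) volume 0 t := by
  have := intervalIntegrable_comp_reflect
    (integral_powerKernel_mul_mlKernel hρ hβ hl one_pos ht).1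
  simpa [powerKernel_one] using this

theorem integral_mlKernel {β : ℝ} (hρ : 0 < ρ) (hβ : 0 < β) (hl : 0 ≤ l) (ht : 0 < t) :
    ∫ s in (0 : ℝ)..t, mlKernel ρ l β s = mlKernel ρ l (1 + β) t := by
  rw [← integral_comp_reflect, ← (integral_powerKernel_mul_mlKernel hρ hβ hl one_pos ht).2]
  simp [powerKernel_one]

theorem mlKernel_one_eq (hρ : 0 < ρ) (hl : 0 ≤ l) (ht : 0 < t) :
    mlKernel ρ l 1 t = 1 - l * ∫ s in (0 : ℝ)..t, mlKernel ρ l ρ s := by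
  rw [integral_mlKernel hρ hρ hl ht, mlKernel_eq_sub hρ one_pos hl ht, powerKernel_one,
    add_comm 1 ρ]

theorem mlKernel_one_eq' (hρ : 0 < ρ) (hl : 0 ≤ l) (ht : 0 < t) :
    mlKernel ρ l 1 t = 1 - l * ∫ s in (0 : ℝ)..t, powerKernel ρ s * mlKernel ρ l 1 (t - s) := by
  rw [(integral_powerKernel_mul_mlKernel hρ one_pos hl hρ ht).2, mlKernel_eq_sub hρ one_pos hl ht,
    powerKernel_one]

theorem mlKernel_le_powerKernel (hρ : 0 < ρ) (hρ1 : ρ ≤ 1) (hl : 0 ≤ l) (ht : 0 < t) :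
    mlKernel ρ l ρ t ≤ powerKernel ρ t := by
  rw [mlKernel_eq_sub hρ hρ hl ht, ← (integral_powerKernel_mul_mlKernel hρ hρ hl hρ ht).2]
  have : 0 ≤ ∫ s in (0 : ℝ)..t, powerKernel ρ s * mlKernel ρ l ρ (t - s) := by
    rw [integral_of_le ht.le, ← integral_Ioc_eq_integral_Ioo.symm]
    exact setIntegral_nonneg measurableSet_Ioo fun s hs =>
      mul_nonneg (powerKernel_nonneg hρ hs.1.le) (mlKernel_pos hρ hρ1 hl (sub_pos.2 hs.2)).le
  have := mul_nonneg hl this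
  linarith

theorem mlKernel_one_antitone (hρ : 0 < ρ) (hρ1 : ρ ≤ 1) (hl : 0 ≤ l) :
    AntitoneOn (mlKernel ρ l 1) (Ioi 0) := by
  intro x hx y hy hxy
  have hx : 0 < x := hx
  have hy : 0 < y := hy
  rw [mlKernel_one_eq hρ hl hx, mlKernel_one_eq hρ hl hy]
  have : ∫ s in (0 : ℝ)..x, mlKernel ρ l ρ s ≤ ∫ s in (0 : ℝ)..y, mlKernel ρ l ρ s := by
    rw [integral_of_le hx.le, integral_of_le hy.le]
    refine setIntegral_mono_set ((intervalIntegrable_iff_integrableOn_Ioc_of_le hy.le).1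
      (intervalIntegrable_mlKernel hρ hρ hl hy)) ?_ (Ioc_subset_Ioc_right hxy).eventuallyLE
    exact (ae_restrict_iff' measurableSet_Ioc).2
      (ae_of_all _ fun s hs => (mlKernel_pos hρ hρ1 hl hs.1).le)
  nlinarith

/-- If the decreasing m became negative at t, it would vanish at some t₀ < t. Passing from t₀ to t
lowers k_ρ(t-s) where m ≥ 0 and adds only a range where m ≤ 0, so m = 1 - l k_ρ * m would give m(t)
≥ m(t₀) = 0. -/
theorem mlKernel_one_nonneg (hρ : 0 < ρ) (hρ1 : ρ ≤ 1) (hl : 0 ≤ l) (ht : 0 < t) :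
    0 ≤ mlKernel ρ l 1 t := by
  by_contra hneg
  have hneg := not_le.1 hneg
  have hanti := mlKernel_one_antitone hρ hρ1 hl
  have hvol : ∀ x > 0, IntervalIntegrable (fun s => powerKernel ρ (x - s) * mlKernel ρ l 1 s)
      volume 0 x ∧ mlKernel ρ l 1 x =
        1 - l * ∫ s in (0 : ℝ)..x, powerKernel ρ (x - s) * mlKernel ρ l 1 s := by
    intro x hx
    constructor
    · have := intervalIntegrable_comp_reflect
        (integral_powerKernel_mul_mlKernel hρ one_pos hl hρ hx).1
      simpa using this
    · rw [← integral_comp_reflect]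
      simp only [sub_sub_cancel]
      exact mlKernel_one_eq' hρ hl hx
  obtain ⟨x, hx, hxpos⟩ : ∃ x ∈ Ioo 0 t, 0 < mlKernel ρ l 1 x := by
    by_contra! hc
    have h := (hvol t ht).2
    have : ∫ s in (0 : ℝ)..t, powerKernel ρ (t - s) * mlKernel ρ l 1 s ≤ 0 := by
      rw [integral_of_le ht.le, ← integral_Ioc_eq_integral_Ioo.symm]
      exact setIntegral_nonpos measurableSet_Ioo fun s hs =>
        mul_nonpos_of_nonneg_of_nonpos (powerKernel_nonneg hρ (sub_nonneg.2 hs.2.le)) (hc s hs)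
    nlinarith
  obtain ⟨t₀, ht₀, hzero⟩ : ∃ t₀ ∈ Icc x t, mlKernel ρ l 1 t₀ = 0 :=
    intermediate_value_Icc' hx.2.le ((continuousOn_mlKernel hρ one_pos hl).mono
      fun y hy => hx.1.trans_le hy.1) ⟨hneg.le, hxpos.le⟩
  have h0 : 0 < t₀ := hx.1.trans_le ht₀.1
  have hi1 : IntervalIntegrable (fun s => powerKernel ρ (t - s) * mlKernel ρ l 1 s) volume 0 t₀ :=
    (hvol t ht).1.mono_set (by
      rw [uIcc_of_le h0.le, uIcc_of_le ht.le]; exact Icc_subset_Icc_right ht₀.2)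
  have hi2 : IntervalIntegrable (fun s => powerKernel ρ (t - s) * mlKernel ρ l 1 s) volume t₀ t :=
    (hvol t ht).1.mono_set (by
      rw [uIcc_of_le ht₀.2, uIcc_of_le ht.le]; exact Icc_subset_Icc_left h0.le)
  have hA : ∫ s in (0 : ℝ)..t₀, powerKernel ρ (t - s) * mlKernel ρ l 1 s ≤
      ∫ s in (0 : ℝ)..t₀, powerKernel ρ (t₀ - s) * mlKernel ρ l 1 s := by
    refine integral_mono_on_of_le_Ioo h0.le hi1 (hvol t₀ h0).1 fun s hs => ?_
    refine mul_le_mul_of_nonneg_right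
      (powerKernel_antitone hρ hρ1 (sub_pos.2 hs.2) (by linarith [ht₀.2])) ?_
    rw [← hzero]
    exact hanti hs.1 h0 hs.2.le
  have hB : ∫ s in t₀..t, powerKernel ρ (t - s) * mlKernel ρ l 1 s ≤ 0 := by
    rw [integral_of_le ht₀.2]
    refine setIntegral_nonpos measurableSet_Ioc fun s hs =>
      mul_nonpos_of_nonneg_of_nonpos (powerKernel_nonneg hρ (sub_nonneg.2 hs.2)) ?_
    rw [← hzero]
    exact hanti h0 (h0.trans hs.1) hs.1.le
  have e1 := (hvol t ht).2
  have e2 := (hvol t₀ h0).2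
  rw [← integral_add_adjacent_intervals hi1 hi2] at e1
  nlinarith

/-- As m decreases, 1 ≥ l (k_ρ * m)(t) ≥ l m(t) ∫ k_ρ. -/
theorem mlKernel_one_le (hρ : 0 < ρ) (hρ1 : ρ ≤ 1) (hl : 0 < l) (ht : 0 < t) :
    mlKernel ρ l 1 t ≤ Real.Gamma (ρ + 1) / (l * t ^ ρ) := by
  have h := mlKernel_one_eq' hρ hl.le ht
  have h0 := mlKernel_one_nonneg hρ hρ1 hl.le ht
  have hG := Real.Gamma_pos_of_pos (add_pos hρ one_pos)
  obtain ⟨hki, hk⟩ := integral_powerKernel hρ ht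
  have : powerKernel (ρ + 1) t * mlKernel ρ l 1 t ≤
      ∫ s in (0 : ℝ)..t, powerKernel ρ s * mlKernel ρ l 1 (t - s) := by
    rw [← hk, ← intervalIntegral.integral_mul_const]
    refine integral_mono_on_of_le_Ioo ht.le (hki.mul_const _)
      (integral_powerKernel_mul_mlKernel hρ one_pos hl.le hρ ht).1 fun s hs => ?_
    exact mul_le_mul_of_nonneg_left (mlKernel_one_antitone hρ hρ1 hl.le (sub_pos.2 hs.2) ht
      (by linarith [hs.1])) (powerKernel_nonneg hρ hs.1.le)
  rw [le_div_iff₀ (by positivity)]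
  have h2 : l * (powerKernel (ρ + 1) t * mlKernel ρ l 1 t) ≤ 1 := by nlinarith
  unfold powerKernel at h2
  rw [add_sub_cancel_right] at h2
  calc mlKernel ρ l 1 t * (l * t ^ ρ)
      = l * (t ^ ρ / Real.Gamma (ρ + 1) * mlKernel ρ l 1 t) * Real.Gamma (ρ + 1) := by field_simp
    _ ≤ 1 * Real.Gamma (ρ + 1) := by gcongr
    _ = _ := one_mul _

/-- An upper bound for `e(t)` in terms of a bound for `e` on `[t / 2, t]`. -/
theorem mul_mlKernel_le (hρ : 0 < ρ) (hρ1 : ρ < 1) (hl : 0 < l) (ht : 0 < t) {B : ℝ}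
    (hB : ∀ x ∈ Icc (t / 2) t, mlKernel ρ l ρ x ≤ B) :
    t * mlKernel ρ l ρ t ≤
      ρ * (Real.Gamma (ρ + 1) * 2 ^ ρ * (l ^ 2 * t ^ ρ)⁻¹ +
        B * (Real.Gamma (ρ + 1) * Real.Gamma (1 - ρ) * l⁻¹ * powerKernel (2 - ρ) t)) := by
  obtain ⟨hi, he⟩ := integral_mlKernel_mul_mlKernel_one hρ hl.le ht
  have ht2 : 0 < t / 2 := half_pos ht
  have ht2' : t / 2 ≤ t := by linarith
  have hB0 : 0 ≤ B := (mlKernel_pos hρ hρ1.le hl.le ht).le.trans (hB t ⟨ht2', le_rfl⟩)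
  have hG := Real.Gamma_pos_of_pos (add_pos hρ one_pos)
  have hG' := Real.Gamma_pos_of_pos (sub_pos.2 hρ1)
  have hi1 := hi.mono_set (c := 0) (d := t / 2) (by
    rw [uIcc_of_le ht2.le, uIcc_of_le ht.le]; exact Icc_subset_Icc_right ht2')
  have hi2 := hi.mono_set (c := t / 2) (d := t) (by
    rw [uIcc_of_le ht2', uIcc_of_le ht.le]; exact Icc_subset_Icc_left ht2.le)
  rw [← he, ← integral_add_adjacent_intervals hi1 hi2]
  refine mul_le_mul_of_nonneg_left (add_le_add ?_ ?_) hρ.le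
  · have hm := mlKernel_one_le hρ hρ1.le hl ht2
    have hm0 := mlKernel_one_nonneg hρ hρ1.le hl.le ht2
    -- On the first half m(t-s) ≤ m(t/2), and m(t/2) ≥ 0 says precisely that l ∫ e ≤ 1.
    have hint : ∫ s in (0 : ℝ)..t / 2, mlKernel ρ l ρ s ≤ l⁻¹ := by
      rw [mlKernel_one_eq hρ hl.le ht2] at hm0
      rw [← one_div, le_div_iff₀ hl]; linarith
    calc ∫ s in (0 : ℝ)..t / 2, mlKernel ρ l ρ s * mlKernel ρ l 1 (t - s)
        ≤ ∫ s in (0 : ℝ)..t / 2, mlKernel ρ l ρ s * mlKernel ρ l 1 (t / 2) := by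
          refine integral_mono_on_of_le_Ioo ht2.le hi1
            ((intervalIntegrable_mlKernel hρ hρ hl.le ht2).mul_const _) fun s hs => ?_
          refine mul_le_mul_of_nonneg_left (mlKernel_one_antitone hρ hρ1.le hl.le ht2 ?_ ?_)
            (mlKernel_pos hρ hρ1.le hl.le hs.1).le
          · have := hs.2
            change 0 < t - s
            linarith
          · linarith [hs.2]
      _ = (∫ s in (0 : ℝ)..t / 2, mlKernel ρ l ρ s) * mlKernel ρ l 1 (t / 2) := by
          rw [intervalIntegral.integral_mul_const]
      _ ≤ l⁻¹ * (Real.Gamma (ρ + 1) / (l * (t / 2) ^ ρ)) := by gcongr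
      _ = _ := by
          rw [Real.div_rpow ht.le (by norm_num)]
          field_simp
  -- On the second half e ≤ B, and the decay of m leaves the singularity (t-s)^(-ρ), integrable
  -- because ρ < 1.
  · have hbd : ∀ s ∈ Ioo (t / 2) t, mlKernel ρ l ρ s * mlKernel ρ l 1 (t - s) ≤
        B * (Real.Gamma (ρ + 1) * Real.Gamma (1 - ρ) * l⁻¹) * powerKernel (1 - ρ) (t - s) := by
      intro s hs
      have hts : 0 < t - s := sub_pos.2 hs.2
      have h1 := hB s ⟨hs.1.le, hs.2.le⟩
      have h2 := mlKernel_one_le hρ hρ1.le hl hts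
      have h3 := mlKernel_one_nonneg hρ hρ1.le hl.le hts
      calc mlKernel ρ l ρ s * mlKernel ρ l 1 (t - s)
          ≤ B * (Real.Gamma (ρ + 1) / (l * (t - s) ^ ρ)) := by gcongr
        _ = _ := by
          unfold powerKernel
          rw [sub_sub_cancel_left, Real.rpow_neg hts.le]
          field_simp
    have hk := integral_powerKernel (sub_pos.2 hρ1) (sub_pos.2 (half_lt_self ht))
    have hik : IntervalIntegrable (fun s => powerKernel (1 - ρ) (t - s)) volume (t / 2) t := by
      have := (hk.1.comp_sub_left t).symm
      simpa using this
    calc ∫ s in t / 2..t, mlKernel ρ l ρ s * mlKernel ρ l 1 (t - s)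
        ≤ ∫ s in t / 2..t, B * (Real.Gamma (ρ + 1) * Real.Gamma (1 - ρ) * l⁻¹) *
            powerKernel (1 - ρ) (t - s) :=
          integral_mono_on_of_le_Ioo ht2' hi2 (hik.const_mul _) hbd
      _ = B * (Real.Gamma (ρ + 1) * Real.Gamma (1 - ρ) * l⁻¹) * powerKernel (2 - ρ) (t - t / 2) := by
          rw [intervalIntegral.integral_const_mul,
            integral_comp_sub_left (fun s => powerKernel (1 - ρ) s), sub_self, hk.2,
            show 1 - ρ + 1 = 2 - ρ by ring]
      _ ≤ B * (Real.Gamma (ρ + 1) * Real.Gamma (1 - ρ) * l⁻¹) * powerKernel (2 - ρ) t := by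
          have : powerKernel (2 - ρ) (t - t / 2) ≤ powerKernel (2 - ρ) t := by
            have := Real.Gamma_pos_of_pos (show 0 < 2 - ρ by linarith)
            unfold powerKernel
            refine div_le_div_of_nonneg_right (Real.rpow_le_rpow ?_ ?_ ?_) this.le <;> linarith
          gcongr
      _ = _ := by ring

/-- Decay of the Mittag-Leffler kernel, uniformly in the spectral parameter `l`. -/
theorem exists_mlKernel_le (hρ : 0 < ρ) (hρ1 : ρ < 1) :
    ∃ C > 0, ∀ l > 0, ∀ t > 0, mlKernel ρ l ρ t ≤ C * t ^ (ρ - 1) ∧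
      mlKernel ρ l ρ t ≤ C * (l ^ 2)⁻¹ * t ^ (-1 - ρ) := by
  have hG := Real.Gamma_pos_of_pos (add_pos hρ one_pos)
  have hG' := Real.Gamma_pos_of_pos (sub_pos.2 hρ1)
  have hG2 := Real.Gamma_pos_of_pos (show 0 < 2 - ρ by linarith)
  have hGρ := Real.Gamma_pos_of_pos hρ
  obtain ⟨c₁, hc₁0, hc₁⟩ : ∃ c > 0, c = ρ * (Real.Gamma (ρ + 1) * 2 ^ ρ) := ⟨_, by positivity, rfl⟩
  obtain ⟨c₂, hc₂0, hc₂⟩ : ∃ c > 0, c = ρ * (Real.Gamma (ρ + 1) * Real.Gamma (1 - ρ) *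
    (Real.Gamma (2 - ρ))⁻¹) := ⟨_, by positivity, rfl⟩
  obtain ⟨c₀, hc₀0, hc₀⟩ : ∃ c > 0, c = (Real.Gamma ρ)⁻¹ := ⟨_, by positivity, rfl⟩
  have hk : ∀ l > 0, ∀ t > 0, mlKernel ρ l ρ t ≤ c₀ * t ^ (ρ - 1) := by
    intro l hl t ht
    refine (mlKernel_le_powerKernel hρ hρ1.le hl.le ht).trans_eq ?_
    rw [hc₀]; unfold powerKernel; ring
  have hstep : ∀ l > 0, ∀ t > 0, ∀ B, (∀ x ∈ Icc (t / 2) t, mlKernel ρ l ρ x ≤ B) →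
      mlKernel ρ l ρ t ≤ c₁ * (l ^ 2)⁻¹ * t ^ (-1 - ρ) + c₂ * B * l⁻¹ * t ^ (-ρ) := by
    intro l hl t ht B hB
    have h := mul_mlKernel_le hρ hρ1 hl ht hB
    rw [mul_comm, ← le_div_iff₀ ht] at h
    refine h.trans_eq ?_
    rw [hc₁, hc₂]
    unfold powerKernel
    rw [show (2 - ρ - 1) = 1 - ρ by ring, Real.rpow_sub ht, Real.rpow_sub ht,
      Real.rpow_neg ht.le, Real.rpow_neg ht.le, Real.rpow_one]
    field_simp
  have hfirst : ∀ l > 0, ∀ t > 0, mlKernel ρ l ρ t ≤ (c₁ + c₂ * (2 * c₀) + c₀) * l⁻¹ * t⁻¹ := by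
    intro l hl t ht
    have htρ : 0 < t ^ ρ := by positivity
    -- First pass, with B from e ≤ c₀ t^(ρ-1). If l t^ρ ≥ 1, the term in l^(-2) is also at most a
    -- multiple of 1/(l t); if l t^ρ < 1, the trivial bound is already that small.
    rcases le_or_gt 1 (l * t ^ ρ) with h | h
    · have hinv : l⁻¹ * (t ^ ρ)⁻¹ ≤ 1 := by rw [← mul_inv]; exact inv_le_one_of_one_le₀ h
      have hs := hstep l hl t ht (2 * c₀ * t ^ (ρ - 1)) (fun x hx => by
        have hx0 : 0 < x := lt_of_lt_of_le (half_pos ht) hx.1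
        refine (hk l hl x hx0).trans ?_
        have h1 : x ^ (ρ - 1) ≤ (t / 2) ^ (ρ - 1) :=
          Real.rpow_le_rpow_of_nonpos (half_pos ht) hx.1 (by linarith)
        have h2 : (t / 2) ^ (ρ - 1) = 2 ^ (1 - ρ) * t ^ (ρ - 1) := by
          rw [Real.div_rpow ht.le (by norm_num), show (1 - ρ) = -(ρ - 1) by ring,
            Real.rpow_neg (by norm_num)]
          field_simp
        have h3 : (2 : ℝ) ^ (1 - ρ) ≤ 2 := by
          calc (2 : ℝ) ^ (1 - ρ) ≤ 2 ^ (1 : ℝ) :=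
                Real.rpow_le_rpow_of_exponent_le (by norm_num) (by linarith)
            _ = 2 := Real.rpow_one 2
        calc c₀ * x ^ (ρ - 1) ≤ c₀ * (2 * t ^ (ρ - 1)) := by
              rw [h2] at h1
              gcongr
              exact h1.trans (by gcongr)
          _ = _ := by ring)
      rw [Real.rpow_sub ht, Real.rpow_neg ht.le, Real.rpow_neg ht.le, Real.rpow_one,
        Real.rpow_sub ht, Real.rpow_one] at hs
      refine hs.trans ?_
      calc c₁ * (l ^ 2)⁻¹ * (t⁻¹ / t ^ ρ) + c₂ * (2 * c₀ * (t ^ ρ / t)) * l⁻¹ * (t ^ ρ)⁻¹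
          = c₁ * l⁻¹ * t⁻¹ * (l⁻¹ * (t ^ ρ)⁻¹) + c₂ * (2 * c₀) * l⁻¹ * t⁻¹ := by field_simp
        _ ≤ c₁ * l⁻¹ * t⁻¹ * 1 + c₂ * (2 * c₀) * l⁻¹ * t⁻¹ + c₀ * l⁻¹ * t⁻¹ := by
            have : 0 ≤ c₀ * l⁻¹ * t⁻¹ := by positivity
            have : c₁ * l⁻¹ * t⁻¹ * (l⁻¹ * (t ^ ρ)⁻¹) ≤ c₁ * l⁻¹ * t⁻¹ * 1 := by gcongr
            linarith
        _ = _ := by ring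
    · refine (hk l hl t ht).trans ?_
      rw [Real.rpow_sub_one ht.ne']
      have h1 : t ^ ρ ≤ l⁻¹ := by rw [← one_div, le_div_iff₀ hl]; linarith
      calc c₀ * (t ^ ρ / t) ≤ c₀ * (l⁻¹ / t) := by gcongr
        _ = c₀ * l⁻¹ * t⁻¹ := by ring
        _ ≤ _ := by
          have : 0 ≤ (c₁ + c₂ * (2 * c₀)) * l⁻¹ * t⁻¹ := by positivity
          nlinarith
  obtain ⟨c₄, hc₄0, hc₄⟩ : ∃ c > 0, c = c₁ + c₂ * (2 * c₀) + c₀ := ⟨_, by positivity, rfl⟩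
  rw [← hc₄] at hfirst
  refine ⟨c₀ + (c₁ + c₂ * (2 * c₄)), by positivity, fun l hl t ht => ⟨?_, ?_⟩⟩
  · refine (hk l hl t ht).trans ?_
    have : 0 ≤ c₁ + c₂ * (2 * c₄) := by positivity
    gcongr; linarith
  -- Second pass: with B of order 1/(l t), both terms are of order l^(-2) t^(-1-ρ).
  · have hs := hstep l hl t ht (2 * c₄ * l⁻¹ * t⁻¹) (fun x hx => by
      have hx0 : 0 < x := lt_of_lt_of_le (half_pos ht) hx.1
      refine (hfirst l hl x hx0).trans ?_
      have : x⁻¹ ≤ (t / 2)⁻¹ := inv_anti₀ (half_pos ht) hx.1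
      calc c₄ * l⁻¹ * x⁻¹ ≤ c₄ * l⁻¹ * (t / 2)⁻¹ := by gcongr
        _ = _ := by field_simp)
    refine hs.trans ?_
    rw [Real.rpow_sub ht, Real.rpow_neg ht.le, Real.rpow_neg ht.le, Real.rpow_one]
    calc c₁ * (l ^ 2)⁻¹ * (t⁻¹ / t ^ ρ) + c₂ * (2 * c₄ * l⁻¹ * t⁻¹) * l⁻¹ * (t ^ ρ)⁻¹
        = (c₁ + c₂ * (2 * c₄)) * (l ^ 2)⁻¹ * (t⁻¹ / t ^ ρ) := by field_simp
      _ ≤ _ := by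
        exact mul_le_mul_of_nonneg_right (mul_le_mul_of_nonneg_right (by linarith)
          (by positivity)) (by positivity)

end bounds

/-! ### One-sided convolution and variation of constants -/

section halfConv

open scoped Convolution

variable {E : Type*} [NormedAddCommGroup E] [NormedSpace ℝ E]

/-- One-sided convolution. -/
noncomputable def halfConv (a : ℝ → ℝ) (h : ℝ → E) (t : ℝ) : E :=
  ∫ s in (0 : ℝ)..t, a s • h (t - s)

theorem halfConv_congr {a b : ℝ → ℝ} {g h : ℝ → E} {t : ℝ} (ht : 0 < t)
    (hab : ∀ s ∈ Ioo 0 t, a s = b s) (hgh : ∀ s ∈ Ioo 0 t, g s = h s) :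
    halfConv a g t = halfConv b h t := by
  unfold halfConv
  rw [integral_of_le ht.le, integral_of_le ht.le, integral_Ioc_eq_integral_Ioo,
    integral_Ioc_eq_integral_Ioo]
  refine setIntegral_congr_fun measurableSet_Ioo fun s hs => ?_
  simp only [hab s hs, hgh (t - s) ⟨by linarith [hs.2], by linarith [hs.1]⟩]

theorem halfConv_comm (a b : ℝ → ℝ) (t : ℝ) : halfConv a b t = halfConv b a t := by
  unfold halfConv
  rw [← integral_comp_reflect]
  simp only [sub_sub_cancel, smul_eq_mul, mul_comm]

theorem halfConv_one (h : ℝ → E) (t : ℝ) :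
    halfConv (fun _ => 1) h t = ∫ s in (0 : ℝ)..t, h s := by
  unfold halfConv
  simp only [one_smul]
  rw [integral_comp_sub_left]; simp

variable {T : ℝ}

/-- Cutting both factors off to (0, T) does not affect the one-sided convolution before time T, so
the results on convolution over the whole line apply. -/
theorem indicator_smul_indicator (a : ℝ → ℝ) (h : ℝ → E) {t : ℝ} (ht : t < T) :
    (fun s => (Ioo 0 T).indicator a s • (Ioo 0 T).indicator h (t - s)) =
      (Ioo 0 t).indicator fun s => a s • h (t - s) := by
  funext s
  by_cases h1 : s ∈ Ioo 0 t
  · rw [indicator_of_mem h1, indicator_of_mem (show s ∈ Ioo 0 T from ⟨h1.1, h1.2.trans ht⟩),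
      indicator_of_mem (show t - s ∈ Ioo 0 T from ⟨by linarith [h1.2], by linarith [h1.1]⟩)]
  · rw [indicator_of_notMem h1]
    by_cases h2 : s ∈ Ioo 0 T
    · rw [indicator_of_notMem (s := Ioo 0 T) (a := t - s), smul_zero]
      exact fun h3 => h1 ⟨h2.1, by linarith [h3.1]⟩
    · rw [indicator_of_notMem h2, zero_smul]

theorem convolution_indicator (a : ℝ → ℝ) (h : ℝ → E) {t : ℝ} (ht : t < T) :
    ((Ioo 0 T).indicator a ⋆[ContinuousLinearMap.lsmul ℝ ℝ] (Ioo 0 T).indicator h) t =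
      (Ioo 0 T).indicator (halfConv a h) t := by
  have h1 : ((Ioo 0 T).indicator a ⋆[ContinuousLinearMap.lsmul ℝ ℝ] (Ioo 0 T).indicator h) t =
      ∫ s, (Ioo 0 T).indicator a s • (Ioo 0 T).indicator h (t - s) := rfl
  rw [h1, indicator_smul_indicator a h ht, MeasureTheory.integral_indicator measurableSet_Ioo]
  by_cases h0 : 0 < t
  · rw [indicator_of_mem (show t ∈ Ioo 0 T from ⟨h0, ht⟩), halfConv, integral_of_le h0.le,
      integral_Ioc_eq_integral_Ioo]
  · rw [indicator_of_notMem (fun h => h0 h.1), Ioo_eq_empty h0]; simp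

theorem ae_intervalIntegrable_halfConv {a : ℝ → ℝ} {h : ℝ → E} (ha : IntegrableOn a (Ioo 0 T))
    (hh : IntegrableOn h (Ioo 0 T)) :
    ∀ᵐ t, t ∈ Ioo 0 T → IntervalIntegrable (fun s => a s • h (t - s)) volume 0 t := by
  have := Integrable.ae_convolution_exists (ContinuousLinearMap.lsmul ℝ ℝ)
    (ha.integrable_indicator measurableSet_Ioo) (hh.integrable_indicator measurableSet_Ioo)
  filter_upwards [this] with t ht h0
  have h1 : Integrable (fun s => (Ioo 0 T).indicator a s • (Ioo 0 T).indicator h (t - s)) := ht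
  rw [indicator_smul_indicator a h h0.2, integrable_indicator_iff measurableSet_Ioo] at h1
  rwa [intervalIntegrable_iff_integrableOn_Ioo_of_le h0.1.le]

theorem integrableOn_halfConv {a : ℝ → ℝ} {h : ℝ → E} (ha : IntegrableOn a (Ioo 0 T))
    (hh : IntegrableOn h (Ioo 0 T)) : IntegrableOn (halfConv a h) (Ioo 0 T) := by
  have := Integrable.integrable_convolution (ContinuousLinearMap.lsmul ℝ ℝ)
    (ha.integrable_indicator measurableSet_Ioo) (hh.integrable_indicator measurableSet_Ioo)
  refine (this.integrableOn (s := Ioo 0 T)).congr_fun (fun t ht => ?_) measurableSet_Ioo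
  rw [convolution_indicator a h ht.2, indicator_of_mem ht]

theorem ae_halfConv_add {a : ℝ → ℝ} {g h : ℝ → E} (ha : IntegrableOn a (Ioo 0 T))
    (hg : IntegrableOn g (Ioo 0 T)) (hh : IntegrableOn h (Ioo 0 T)) :
    ∀ᵐ t, t ∈ Ioo 0 T →
      halfConv a (fun s => g s + h s) t = halfConv a g t + halfConv a h t := by
  filter_upwards [ae_intervalIntegrable_halfConv ha hg, ae_intervalIntegrable_halfConv ha hh]
    with t h1 h2 ht
  unfold halfConv
  rw [← intervalIntegral.integral_add (h1 ht) (h2 ht)]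
  simp only [smul_add]

theorem ae_add_halfConv {a b : ℝ → ℝ} {h : ℝ → E} (ha : IntegrableOn a (Ioo 0 T))
    (hb : IntegrableOn b (Ioo 0 T)) (hh : IntegrableOn h (Ioo 0 T)) :
    ∀ᵐ t, t ∈ Ioo 0 T →
      halfConv (fun s => a s + b s) h t = halfConv a h t + halfConv b h t := by
  filter_upwards [ae_intervalIntegrable_halfConv ha hh, ae_intervalIntegrable_halfConv hb hh]
    with t h1 h2 ht
  unfold halfConv
  rw [← intervalIntegral.integral_add (h1 ht) (h2 ht)]
  simp only [add_smul]

theorem halfConv_const_smul (a : ℝ → ℝ) (h : ℝ → E) (c t : ℝ) :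
    halfConv a (fun s => c • h s) t = c • halfConv a h t := by
  unfold halfConv
  rw [← intervalIntegral.integral_smul]
  simp only [smul_comm c]

theorem const_mul_halfConv (a : ℝ → ℝ) (h : ℝ → E) (c t : ℝ) :
    halfConv (fun s => c * a s) h t = c • halfConv a h t := by
  unfold halfConv
  rw [← intervalIntegral.integral_smul]
  simp only [mul_smul]

theorem ae_halfConv_assoc [CompleteSpace E] {a b : ℝ → ℝ} {h : ℝ → E}
    (ha : IntegrableOn a (Ioo 0 T))
    (hb : IntegrableOn b (Ioo 0 T)) (hh : IntegrableOn h (Ioo 0 T)) :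
    ∀ᵐ t, t ∈ Ioo 0 T → halfConv (halfConv a b) h t = halfConv a (halfConv b h) t := by
  have hA := ha.integrable_indicator measurableSet_Ioo
  have hB := hb.integrable_indicator measurableSet_Ioo
  have hH := hh.integrable_indicator measurableSet_Ioo
  have hAB := Integrable.ae_convolution_exists (ContinuousLinearMap.lsmul ℝ ℝ) hA hB
  have hBH := Integrable.ae_convolution_exists (ContinuousLinearMap.mul ℝ ℝ) hB.norm hH.norm
  have hABH := Integrable.ae_convolution_exists (ContinuousLinearMap.mul ℝ ℝ) hA.norm
    (Integrable.integrable_convolution (ContinuousLinearMap.mul ℝ ℝ) hB.norm hH.norm)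
  filter_upwards [hABH] with t h1 ht
  have key := convolution_assoc (ContinuousLinearMap.lsmul ℝ ℝ) (ContinuousLinearMap.lsmul ℝ ℝ)
    (ContinuousLinearMap.lsmul ℝ ℝ) (ContinuousLinearMap.lsmul ℝ ℝ) (𝕜 := ℝ)
    (fun x y (z : E) => (mul_smul x y z :)) hA.1 hB.1 hH.1 hAB hBH h1
  have hL : (((Ioo 0 T).indicator a ⋆[ContinuousLinearMap.lsmul ℝ ℝ] (Ioo 0 T).indicator b)
      ⋆[ContinuousLinearMap.lsmul ℝ ℝ] (Ioo 0 T).indicator h) t =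
      ((Ioo 0 T).indicator (halfConv a b)
        ⋆[ContinuousLinearMap.lsmul ℝ ℝ] (Ioo 0 T).indicator h) t := by
    refine integral_congr_ae (ae_of_all _ fun s => ?_)
    simp only [ContinuousLinearMap.lsmul_apply]
    -- The cut-off identity is available only for s < T; for s ≥ T the other factor vanishes since t
    -- - s < 0.
    rcases lt_or_ge s T with hs | hs
    · rw [convolution_indicator a b hs]
    · rw [indicator_of_notMem (s := Ioo 0 T) (a := t - s) (fun h => by linarith [h.1, ht.2]),
        smul_zero, smul_zero]
  have hR : ((Ioo 0 T).indicator a ⋆[ContinuousLinearMap.lsmul ℝ ℝ]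
      ((Ioo 0 T).indicator b ⋆[ContinuousLinearMap.lsmul ℝ ℝ] (Ioo 0 T).indicator h)) t =
      ((Ioo 0 T).indicator a
        ⋆[ContinuousLinearMap.lsmul ℝ ℝ] (Ioo 0 T).indicator (halfConv b h)) t := by
    refine integral_congr_ae (ae_of_all _ fun s => ?_)
    simp only [ContinuousLinearMap.lsmul_apply]
    by_cases hs : s ∈ Ioo 0 T
    · rw [convolution_indicator b h (by linarith [hs.1, ht.2])]
    · rw [indicator_of_notMem hs, zero_smul, zero_smul]
  rw [hL, hR, convolution_indicator _ _ ht.2, convolution_indicator _ _ ht.2,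
    indicator_of_mem ht, indicator_of_mem ht] at key
  exact key

/-- The primitive is continuous, so it vanishes everywhere on (0, T); Lebesgue differentiation then
gives the claim. -/
theorem ae_eq_zero_of_ae_integral_eq_zero [CompleteSpace E] {Z : ℝ → E} (hT : 0 < T)
    (hZ : IntegrableOn Z (Ioo 0 T))
    (h : ∀ᵐ t, t ∈ Ioo 0 T → ∫ s in (0 : ℝ)..t, Z s = 0) : ∀ᵐ t, t ∈ Ioo 0 T → Z t = 0 := by
  have hi : IntervalIntegrable Z volume 0 T := by
    rwa [intervalIntegrable_iff_integrableOn_Ioo_of_le hT.le]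
  have hcont : ContinuousOn (fun t => ∫ s in (0 : ℝ)..t, Z s) (Ioo 0 T) := by
    have := continuousOn_primitive_interval' hi left_mem_uIcc
    rw [uIcc_of_le hT.le] at this
    exact this.mono Ioo_subset_Icc_self
  have hall : EqOn (fun t => ∫ s in (0 : ℝ)..t, Z s) (fun _ => 0) (Ioo 0 T) :=
    Measure.eqOn_open_of_ae_eq ((ae_restrict_iff' measurableSet_Ioo).2 h) isOpen_Ioo hcont
      continuousOn_const
  filter_upwards [hi.ae_hasDerivAt_integral] with t ht h0
  have h1 := ht (by rw [uIcc_of_le hT.le]; exact Ioo_subset_Icc_self h0) 0 left_mem_uIcc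
  have h2 : HasDerivAt (fun t => ∫ s in (0 : ℝ)..t, Z s) 0 t :=
    (hasDerivAt_const t (0 : E)).congr_of_eventuallyEq
      (hall.eventuallyEq_of_mem (isOpen_Ioo.mem_nhds h0))
  exact h1.unique h2

/-- Variation of constants: if `k * e = 1 - l (1 * e)` and `k * U = φ + 1 * (F - l U)` on `(0, T)`
then `U = e φ + e * F` almost everywhere on `(0, T)`. -/
theorem ae_eq_of_resolvent [CompleteSpace E] (hT : 0 < T) {k e : ℝ → ℝ} {U F : ℝ → E} {φ : E}
    {l : ℝ} (hk : IntegrableOn k (Ioo 0 T)) (he : IntegrableOn e (Ioo 0 T))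
    (hU : IntegrableOn U (Ioo 0 T)) (hF : IntegrableOn F (Ioo 0 T))
    (hres : ∀ t ∈ Ioo 0 T, halfConv k e t = 1 - l * ∫ s in (0 : ℝ)..t, e s)
    (heq : ∀ t ∈ Ioo 0 T, halfConv k U t = φ + ∫ s in (0 : ℝ)..t, (F s - l • U s)) :
    ∀ᵐ t, t ∈ Ioo 0 T → U t = e t • φ + halfConv e F t := by
  have hfin : volume (Ioo 0 T) ≠ ⊤ := by simp
  have h1 : IntegrableOn (fun _ : ℝ => (1 : ℝ)) (Ioo 0 T) := integrableOn_const hfin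
  have hφ : IntegrableOn (fun _ : ℝ => φ) (Ioo 0 T) := integrableOn_const hfin
  have heφ : IntegrableOn (fun s => e s • φ) (Ioo 0 T) := he.smul_const φ
  have hnU : IntegrableOn (fun s => (-l) • U s) (Ioo 0 T) := hU.smul (-l)
  have hY : IntegrableOn (fun s => F s + (-l) • U s) (Ioo 0 T) := hF.add hnU
  have h1e := integrableOn_halfConv h1 he
  have heU := integrableOn_halfConv he hU
  have heF := integrableOn_halfConv he hF
  have heY := integrableOn_halfConv he hY
  have hii : ∀ {g : ℝ → E}, IntegrableOn g (Ioo 0 T) → ∀ t ∈ Ioo 0 T,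
      IntervalIntegrable g volume 0 t := fun hg t ht => by
    rw [intervalIntegrable_iff_integrableOn_Ioo_of_le ht.1.le]
    exact hg.mono_set (Ioo_subset_Ioo_right ht.2.le)
  have hZ : IntegrableOn (fun s => U s - (e s • φ + halfConv e F s)) (Ioo 0 T) :=
    hU.sub (heφ.add heF)
  have hadd := ae_halfConv_add he hF hnU
  refine (ae_eq_zero_of_ae_integral_eq_zero hT hZ ?_).mono fun t h ht => sub_eq_zero.1 (h ht)
  filter_upwards [ae_halfConv_assoc he hk hU, ae_halfConv_assoc he h1 hY,
    ae_halfConv_assoc h1 he hY, ae_halfConv_add he hφ (integrableOn_halfConv h1 hY),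
    ae_add_halfConv h1 (h1e.const_mul (-l)) hU, ae_halfConv_assoc h1 he hU]
    with t a1 a2 a3 a4 a5 a6 ht
  -- Evaluate e * k * U in two ways: the equation for U gives e * φ + 1 * (e * F) - l 1 * (e * U),
  -- the resolvent identity gives 1 * U - l 1 * (e * U). The last terms cancel, leaving the
  -- integrated form of the claim.
  have b1 : halfConv e (halfConv k U) t =
      halfConv e (fun s => φ + halfConv (fun _ => 1) (fun s => F s + (-l) • U s) s) t := by
    refine halfConv_congr ht.1 (fun _ _ => rfl) fun s hs => ?_
    rw [heq s ⟨hs.1, hs.2.trans ht.2⟩, halfConv_one]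
    simp only [neg_smul, sub_eq_add_neg]
  have b2 : halfConv (halfConv e k) U t =
      halfConv (fun s => 1 + -l * halfConv (fun _ => 1) e s) U t := by
    refine halfConv_congr ht.1 (fun s hs => ?_) fun _ _ => rfl
    rw [halfConv_comm, hres s ⟨hs.1, hs.2.trans ht.2⟩, halfConv_one]; ring
  have b3 : halfConv e (fun _ => φ) t = ∫ s in (0 : ℝ)..t, e s • φ := rfl
  have b4 : halfConv (halfConv e fun _ => 1) (fun s => F s + (-l) • U s) t =
      halfConv (halfConv (fun _ => 1) e) (fun s => F s + (-l) • U s) t :=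
    halfConv_congr ht.1 (fun s _ => halfConv_comm _ _ s) fun _ _ => rfl
  have b5 : ∫ s in (0 : ℝ)..t, halfConv e (fun s => F s + (-l) • U s) s =
      (∫ s in (0 : ℝ)..t, halfConv e F s) + (-l) • ∫ s in (0 : ℝ)..t, halfConv e U s := by
    have hlU : IntervalIntegrable (fun s => (-l) • halfConv e U s) volume 0 t :=
      (hii heU t ht).smul _
    rw [← intervalIntegral.integral_smul, ← intervalIntegral.integral_add (hii heF t ht) hlU]
    refine integral_congr_ae ?_
    filter_upwards [hadd] with s hs h0
    rw [uIoc_of_le ht.1.le] at h0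
    rw [hs ⟨h0.1, h0.2.trans_lt ht.2⟩, halfConv_const_smul]
  have c := a1 ht
  rw [b1, b2, a4 ht, a5 ht, const_mul_halfConv, a6 ht, b3, ← a2 ht, b4, a3 ht, halfConv_one,
    halfConv_one, halfConv_one, b5] at c
  have hrhs : IntervalIntegrable (fun s => e s • φ + halfConv e F s) volume 0 t :=
    hii (heφ.add heF) t ht
  rw [intervalIntegral.integral_sub (hii hU t ht) hrhs,
    intervalIntegral.integral_add (hii heφ t ht) (hii heF t ht), sub_eq_zero]
  rw [← add_assoc] at c
  exact add_right_cancel c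

end halfConv

/-- Representation of the solution of the scalar fractional equation. -/
theorem ae_eq_mlKernel_of_fractional {E : Type*} [NormedAddCommGroup E] [NormedSpace ℝ E]
    [CompleteSpace E] {ρ l T : ℝ} (hρ : 0 < ρ) (hρ1 : ρ < 1) (hl : 0 ≤ l) (hT : 0 < T)
    {U F : ℝ → E} {φ : E}
    (hU : IntegrableOn U (Ioo 0 T)) (hF : IntegrableOn F (Ioo 0 T))
    (heq : ∀ t ∈ Ioo 0 T, halfConv (powerKernel (1 - ρ)) U t =
      φ + ∫ s in (0 : ℝ)..t, (F s - l • U s)) :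
    ∀ᵐ t, t ∈ Ioo 0 T → U t = mlKernel ρ l ρ t • φ + halfConv (mlKernel ρ l ρ) F t := by
  refine ae_eq_of_resolvent hT ?_ ?_ hU hF (fun t ht => ?_) heq
  · exact (intervalIntegrable_iff_integrableOn_Ioo_of_le hT.le).1
      (integral_powerKernel (sub_pos.2 hρ1) hT).1
  · exact (intervalIntegrable_iff_integrableOn_Ioo_of_le hT.le).1
      (intervalIntegrable_mlKernel hρ hρ hl hT)
  -- The indices add to (1-ρ) + ρ = 1, so k_(1-ρ) * e = m.
  · rw [← mlKernel_one_eq hρ hl ht.1]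
    have := (integral_powerKernel_mul_mlKernel hρ hρ hl (sub_pos.2 hρ1) ht.1).2
    rwa [sub_add_cancel] at this

/-! ### Interpolated kernel bound, Minkowski's inequality, passage to the endpoint -/

/-- Interpolation between the two bounds of the Mittag-Leffler kernel. -/
theorem exists_sq_mul_mlKernel_le {ρ ε μ : ℝ} (hρ : 0 < ρ) (hρ1 : ρ < 1) (hε : 0 < ε)
    (hμ : 0 < μ) : ∃ D > 0, ∀ l > 0, (ε < 1 ∨ μ ≤ l) → ∀ t > 0,
      l ^ 2 * mlKernel ρ l ρ t ≤ D * l ^ (1 + ε) * t ^ (ρ * min ε 1 - 1) := by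
  obtain ⟨C, hC, h⟩ := exists_mlKernel_le hρ hρ1
  have hmu : 0 < μ ^ (1 - ε) := by positivity
  refine ⟨C + C * μ ^ (1 - ε), by positivity, fun l hl hor t ht => ?_⟩
  obtain ⟨h1, h2⟩ := h l hl t ht
  have h0 := mlKernel_pos hρ hρ1.le hl.le ht
  rcases lt_or_ge ε 1 with hε1 | hε1
  · rw [min_eq_left hε1.le]
    set e := mlKernel ρ l ρ t
    -- The weight for which l^(2 - 2(1-θ)) = l^(1+ε); the power of t is then ρ(2θ-1) - 1 = ρε - 1.
    set θ := (1 + ε) / 2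
    have hsplit : e = e ^ θ * e ^ (1 - θ) := by
      rw [← Real.rpow_add h0, add_sub_cancel, Real.rpow_one]
    have hθ : 0 ≤ θ := by positivity
    have hθ1 : 0 ≤ 1 - θ := by simp only [θ]; linarith
    have h3 : e ≤ (C * t ^ (ρ - 1)) ^ θ * (C * (l ^ 2)⁻¹ * t ^ (-1 - ρ)) ^ (1 - θ) := by
      rw [hsplit]
      exact mul_le_mul (Real.rpow_le_rpow h0.le h1 hθ) (Real.rpow_le_rpow h0.le h2 hθ1)
        (by positivity) (by positivity)
    have h4 : l ^ 2 * ((C * t ^ (ρ - 1)) ^ θ * (C * (l ^ 2)⁻¹ * t ^ (-1 - ρ)) ^ (1 - θ)) =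
        C * l ^ (1 + ε) * t ^ (ρ * ε - 1) := by
      have hl2 : (l ^ 2)⁻¹ = l ^ (-2 : ℝ) := by
        rw [Real.rpow_neg hl.le]; norm_num
      rw [hl2, Real.mul_rpow hC.le (by positivity), Real.mul_rpow (by positivity) (by positivity),
        Real.mul_rpow hC.le (by positivity), ← Real.rpow_mul ht.le, ← Real.rpow_mul ht.le,
        ← Real.rpow_mul hl.le]
      have e1 : C ^ θ * C ^ (1 - θ) = C := by
        rw [← Real.rpow_add hC, add_sub_cancel, Real.rpow_one]
      have e2 : t ^ ((ρ - 1) * θ) * t ^ ((-1 - ρ) * (1 - θ)) = t ^ (ρ * ε - 1) := by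
        rw [← Real.rpow_add ht]; congr 1; simp only [θ]; ring
      have e3 : l ^ 2 * l ^ (-2 * (1 - θ)) = l ^ (1 + ε) := by
        rw [← Real.rpow_natCast l 2, ← Real.rpow_add hl]; congr 1; simp only [θ]; push_cast; ring
      rw [← e2, ← e3]
      nth_rewrite 3 [← e1]
      ring
    calc l ^ 2 * e ≤ C * l ^ (1 + ε) * t ^ (ρ * ε - 1) := by rw [← h4]; gcongr
      _ ≤ _ := by
        gcongr
        exact le_add_of_nonneg_right (by positivity)
  -- For ε ≥ 1 the first bound suffices, but l² is controlled by l^(1+ε) only for l bounded below.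
  -- This is the only use of μ ≤ l.
  · have hml : μ ≤ l := hor.resolve_left hε1.not_gt
    rw [min_eq_right hε1, mul_one]
    have h3 : l ^ 2 ≤ μ ^ (1 - ε) * l ^ (1 + ε) := by
      have e3 : l ^ 2 = l ^ (1 - ε) * l ^ (1 + ε) := by
        rw [← Real.rpow_natCast l 2, ← Real.rpow_add hl]; congr 1; push_cast; ring
      rw [e3]
      exact mul_le_mul_of_nonneg_right (Real.rpow_le_rpow_of_nonpos hμ hml (by linarith))
        (by positivity)
    calc l ^ 2 * mlKernel ρ l ρ t ≤ (μ ^ (1 - ε) * l ^ (1 + ε)) * (C * t ^ (ρ - 1)) := by gcongr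
      _ = C * μ ^ (1 - ε) * l ^ (1 + ε) * t ^ (ρ - 1) := by ring
      _ ≤ _ := by
        gcongr
        exact le_add_of_nonneg_left hC.le

/-- Minkowski's integral inequality for a finite family of functions. -/
theorem sum_sq_integral_le {ι α : Type*} [MeasurableSpace α] {ν : Measure α} (S : Finset ι)
    {w : α → ℝ} {a : ι → α → ℝ} {M : ℝ} (hM : 0 ≤ M) (hw : Integrable w ν)
    (hwa : ∀ i ∈ S, Integrable (fun s => w s * a i s) ν) (hw0 : ∀ᵐ s ∂ν, 0 ≤ w s)
    (hS : ∀ᵐ s ∂ν, ∑ i ∈ S, a i s ^ 2 ≤ M ^ 2) :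
    ∑ i ∈ S, (∫ s, w s * a i s ∂ν) ^ 2 ≤ (M * ∫ s, w s ∂ν) ^ 2 := by
  set I : ι → ℝ := fun i => ∫ s, w s * a i s ∂ν
  set Q := ∑ i ∈ S, I i ^ 2
  have hQ0 : 0 ≤ Q := Finset.sum_nonneg fun i _ => sq_nonneg _
  have hW : 0 ≤ ∫ s, w s ∂ν := integral_nonneg_of_ae hw0
  have h1 : Q = ∫ s, w s * ∑ i ∈ S, I i * a i s ∂ν := by
    have : ∀ s, w s * ∑ i ∈ S, I i * a i s = ∑ i ∈ S, I i * (w s * a i s) := fun s => by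
      rw [Finset.mul_sum]; exact Finset.sum_congr rfl fun i _ => by ring
    simp_rw [this]
    rw [integral_finsetSum S fun i hi => (hwa i hi).const_mul _]
    exact Finset.sum_congr rfl fun i _ => by rw [MeasureTheory.integral_const_mul, sq]
  -- Duality: test the vector of integrals against itself, apply Cauchy-Schwarz under the integral,
  -- then divide by √Q.
  have h2 : Q ≤ √Q * (M * ∫ s, w s ∂ν) := by
    calc Q = ∫ s, w s * ∑ i ∈ S, I i * a i s ∂ν := h1
      _ ≤ ∫ s, w s * (√Q * M) ∂ν := by
        refine integral_mono_ae ?_ (hw.mul_const _) ?_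
        · have : ∀ s, w s * ∑ i ∈ S, I i * a i s = ∑ i ∈ S, I i * (w s * a i s) := fun s => by
            rw [Finset.mul_sum]; exact Finset.sum_congr rfl fun i _ => by ring
          simp_rw [this]
          exact integrable_finsetSum S fun i hi => (hwa i hi).const_mul _
        · filter_upwards [hw0, hS] with s hs hs'
          refine mul_le_mul_of_nonneg_left ((Real.sum_mul_le_sqrt_mul_sqrt S _ _).trans ?_) hs
          exact mul_le_mul_of_nonneg_left (Real.sqrt_le_iff.2 ⟨hM, hs'⟩) (Real.sqrt_nonneg _)
      _ = _ := by rw [MeasureTheory.integral_mul_const]; ring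
  have h3 : √Q ≤ M * ∫ s, w s ∂ν := by
    rcases (Real.sqrt_nonneg Q).eq_or_lt with h | h
    · rw [← h]; positivity
    · refine le_of_mul_le_mul_left ?_ h
      rwa [Real.mul_self_sqrt hQ0]
  calc Q = √Q ^ 2 := (Real.sq_sqrt hQ0).symm
    _ ≤ _ := pow_le_pow_left₀ (Real.sqrt_nonneg _) h3 2

/-- The inequality is recast as the equation max(h, b) = b, since almost everywhere equal continuous
functions on (0, T] agree also at T. -/
theorem le_of_ae_le_of_continuousOn_Ioc {h b : ℝ → ℝ} {T : ℝ} (hT : 0 < T)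
    (hh : ContinuousOn h (Ioc 0 T)) (hb : ContinuousOn b (Ioc 0 T))
    (hle : ∀ᵐ t, t ∈ Ioo 0 T → h t ≤ b t) : h T ≤ b T := by
  have hae : (fun t => max (h t) (b t)) =ᵐ[volume.restrict (Ioc 0 T)] b := by
    rw [← restrict_Ioo_eq_restrict_Ioc]
    exact (ae_restrict_iff' measurableSet_Ioo).2 (hle.mono fun t ht h0 => max_eq_right (ht h0))
  have := Measure.eqOn_Ioc_of_ae_eq volume hae (ContinuousOn.sup hh hb) hb (right_mem_Ioc.2 hT)
  exact max_eq_right_iff.1 this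

/-! ### The norms of D(A^τ) and the coefficients of A -/

section powNorm

variable {𝕜 H : Type*} [RCLike 𝕜] [NormedAddCommGroup H] [InnerProductSpace 𝕜 H]
  {v : HilbertBasis ℕ 𝕜 H} {lam : ℕ → ℝ} {τ T : ℝ} {g : ℝ → H}

theorem powNorm_nonneg (x : H) : 0 ≤ powNorm v lam τ x := Real.sqrt_nonneg _

theorem powNorm_sq (hl : ∀ k, 0 < lam k) (x : H) :
    powNorm v lam τ x ^ 2 = ∑' k, lam k ^ (2 * τ) * ‖inner 𝕜 (v k) x‖ ^ 2 :=
  Real.sq_sqrt (tsum_nonneg fun k => by have := hl k; positivity)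

theorem powTerm_add_le (hl : ∀ k, 0 < lam k) (x y : H) (k : ℕ) :
    lam k ^ (2 * τ) * ‖inner 𝕜 (v k) (x + y)‖ ^ 2 ≤
      2 * (lam k ^ (2 * τ) * ‖inner 𝕜 (v k) x‖ ^ 2) +
        2 * (lam k ^ (2 * τ) * ‖inner 𝕜 (v k) y‖ ^ 2) := by
  have h := hl k
  have h1 : ‖inner 𝕜 (v k) (x + y)‖ ≤ ‖inner 𝕜 (v k) x‖ + ‖inner 𝕜 (v k) y‖ := by
    rw [inner_add_right]; exact norm_add_le _ _
  have h2 : ‖inner 𝕜 (v k) (x + y)‖ ^ 2 ≤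
      2 * ‖inner 𝕜 (v k) x‖ ^ 2 + 2 * ‖inner 𝕜 (v k) y‖ ^ 2 := by
    calc _ ≤ (‖inner 𝕜 (v k) x‖ + ‖inner 𝕜 (v k) y‖) ^ 2 :=
          pow_le_pow_left₀ (norm_nonneg _) h1 2
      _ ≤ _ := by nlinarith [sq_nonneg (‖inner 𝕜 (v k) x‖ - ‖inner 𝕜 (v k) y‖)]
  have h3 : 0 ≤ lam k ^ (2 * τ) := by positivity
  nlinarith

theorem powDomain_add (hl : ∀ k, 0 < lam k) {x y : H} (hx : x ∈ powDomain v lam τ)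
    (hy : y ∈ powDomain v lam τ) : x + y ∈ powDomain v lam τ :=
  Summable.of_nonneg_of_le (fun k => by have := hl k; positivity) (powTerm_add_le hl x y)
    ((Summable.mul_left 2 hx).add (Summable.mul_left 2 hy))

theorem powDomain_sub (hl : ∀ k, 0 < lam k) {x y : H} (hx : x ∈ powDomain v lam τ)
    (hy : y ∈ powDomain v lam τ) : x - y ∈ powDomain v lam τ := by
  rw [sub_eq_add_neg]
  refine powDomain_add hl hx ?_
  simpa [powDomain] using hy

theorem powNorm_add_sq_le (hl : ∀ k, 0 < lam k) {x y : H} (hx : x ∈ powDomain v lam τ)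
    (hy : y ∈ powDomain v lam τ) :
    powNorm v lam τ (x + y) ^ 2 ≤ 2 * powNorm v lam τ x ^ 2 + 2 * powNorm v lam τ y ^ 2 := by
  rw [powNorm_sq hl, powNorm_sq hl, powNorm_sq hl, ← tsum_mul_left, ← tsum_mul_left,
    ← Summable.tsum_add (Summable.mul_left 2 hx) (Summable.mul_left 2 hy)]
  exact Summable.tsum_le_tsum (powTerm_add_le hl x y) (powDomain_add hl hx hy)
    ((Summable.mul_left 2 hx).add (Summable.mul_left 2 hy))

theorem sum_le_powNorm_sq (hl : ∀ k, 0 < lam k) {x : H} (hx : x ∈ powDomain v lam τ)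
    (S : Finset ℕ) :
    ∑ k ∈ S, lam k ^ (2 * τ) * ‖inner 𝕜 (v k) x‖ ^ 2 ≤ powNorm v lam τ x ^ 2 := by
  rw [powNorm_sq hl]
  exact Summable.sum_le_tsum S (fun k _ => by have := hl k; positivity) hx

theorem rpow_mul_norm_inner_le_powNorm (hl : ∀ k, 0 < lam k) {x : H}
    (hx : x ∈ powDomain v lam τ) (k : ℕ) :
    lam k ^ τ * ‖inner 𝕜 (v k) x‖ ≤ powNorm v lam τ x := by
  have h := sum_le_powNorm_sq hl hx {k}
  have hk := hl k
  rw [Finset.sum_singleton, mul_comm 2 τ, Real.rpow_mul hk.le,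
    show (2 : ℝ) = ((2 : ℕ) : ℝ) by norm_num, Real.rpow_natCast, ← mul_pow] at h
  exact le_of_sq_le_sq h (powNorm_nonneg _)

theorem IsContinuousInPowDomain.continuousOn_inner (hg : IsContinuousInPowDomain v lam τ T g)
    (hl : ∀ k, 0 < lam k) (k : ℕ) :
    ContinuousOn (fun t => inner 𝕜 (v k) (g t)) (Icc 0 T) := by
  intro t₀ ht₀
  have hk := hl k
  have hpos : 0 < lam k ^ τ := by positivity
  rw [ContinuousWithinAt, tendsto_iff_norm_sub_tendsto_zero]
  have hlim := (hg.continuous t₀ ht₀).const_mul (lam k ^ τ)⁻¹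
  rw [mul_zero] at hlim
  refine squeeze_zero' (Eventually.of_forall fun _ => norm_nonneg _) ?_ hlim
  filter_upwards [self_mem_nhdsWithin] with t ht
  have h := rpow_mul_norm_inner_le_powNorm hl
    (powDomain_sub hl (hg.mem t ht) (hg.mem t₀ ht₀)) k
  rw [← inner_sub_right, ← div_eq_inv_mul, le_div_iff₀ hpos]
  linarith

/-- Local bounds plus compactness of [0, T]. Boundedness is needed for `maxPowNorm` to be a genuine
bound: the supremum of an unbounded set defaults to 0. -/
theorem IsContinuousInPowDomain.bddAbove (hg : IsContinuousInPowDomain v lam τ T g)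
    (hl : ∀ k, 0 < lam k) : BddAbove ((fun t => powNorm v lam τ (g t)) '' Icc 0 T) := by
  suffices h : BddAbove ((fun t => powNorm v lam τ (g t)) '' (Icc 0 T ∩ Icc 0 T)) by
    rwa [inter_self] at h
  refine isCompact_Icc.induction_on (p := fun s => BddAbove ((fun t => powNorm v lam τ (g t)) ''
    (s ∩ Icc 0 T))) (by simp) (fun s t hst ht => ht.mono (by gcongr))
    (fun s t hs ht => ?_) (fun t₀ ht₀ => ?_)
  · rw [union_inter_distrib_right, image_union]; exact hs.union ht
  · refine ⟨_, inter_mem self_mem_nhdsWithin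
      ((hg.continuous t₀ ht₀).eventually_lt_const one_pos),
      √(2 * 1 ^ 2 + 2 * powNorm v lam τ (g t₀) ^ 2), ?_⟩
    rintro _ ⟨t, ⟨⟨ht, ht1⟩, -⟩, rfl⟩
    refine Real.le_sqrt_of_sq_le ?_
    have h := powNorm_add_sq_le hl (powDomain_sub hl (hg.mem t ht) (hg.mem t₀ ht₀)) (hg.mem t₀ ht₀)
    rw [sub_add_cancel] at h
    have h2 : powNorm v lam τ (g t - g t₀) ^ 2 ≤ 1 ^ 2 :=
      pow_le_pow_left₀ (powNorm_nonneg _) (le_of_lt ht1) 2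
    simp only
    linarith

theorem IsContinuousInPowDomain.powNorm_le (hg : IsContinuousInPowDomain v lam τ T g)
    (hl : ∀ k, 0 < lam k) {t : ℝ} (ht : t ∈ Icc 0 T) :
    powNorm v lam τ (g t) ≤ maxPowNorm v lam τ T g :=
  le_csSup (hg.bddAbove hl) (mem_image_of_mem _ ht)

theorem IsPositiveDiscrete.lam_pos [CompleteSpace H] {A : H →ₗ.[𝕜] H}
    (hA : IsPositiveDiscrete A v lam) (k : ℕ) : 0 < lam k :=
  hA.pos.trans_le (hA.mono (Nat.zero_le k))

/-- Self-adjointness moves A onto the eigenvector, and the eigenvalue is real. -/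
theorem IsPositiveDiscrete.inner_apply [CompleteSpace H] {A : H →ₗ.[𝕜] H}
    (hA : IsPositiveDiscrete A v lam) (k : ℕ) (x : A.domain) :
    inner 𝕜 (v k) (A x) = (lam k : 𝕜) * inner 𝕜 (v k) (x : H) := by
  have h := LinearPMap.adjoint_isFormalAdjoint hA.isSelfAdjoint.dense_domain
  rw [LinearPMap.isSelfAdjoint_def.1 hA.isSelfAdjoint] at h
  have h1 := h ⟨v k, hA.eigenvector_mem k⟩ x
  rw [hA.eigenvector_apply k, inner_smul_left] at h1
  simpa using h1.symm

end powNorm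

/-! ### Coefficients of a solution -/

section components

variable {𝕜 H : Type*} [RCLike 𝕜] [NormedAddCommGroup H] [InnerProductSpace 𝕜 H]
  [NormedSpace ℝ H]
  {A : H →ₗ.[𝕜] H} {v : HilbertBasis ℕ 𝕜 H} {lam : ℕ → ℝ} {ρ T τ : ℝ} {φ : H} {f g u : ℝ → H}

/-- Near 0 integrability comes from that of (T/2 - ξ)^(-ρ) u(ξ), multiplied by the bounded function
(T/2 - ξ)^ρ; away from 0 it comes from continuity up to T. -/
theorem IsForwardSolution.integrableOn_inner (hu : IsForwardSolution A ρ T f φ u)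
    (hρ : 0 < ρ) (hT : 0 < T) (c : H →L[ℝ] 𝕜) :
    IntegrableOn (fun t => c (u t)) (Ioo 0 T) := by
  have hT2 : 0 < T / 2 := half_pos hT
  have h1 := hu.integrable (T / 2) ⟨hT2, half_lt_self hT⟩
  rw [intervalIntegrable_iff_integrableOn_Ioo_of_le hT2.le] at h1
  have hcont : ContinuousOn (fun ξ : ℝ => (T / 2 - ξ) ^ ρ) (Icc 0 (T / 2)) :=
    ((Real.continuous_rpow_const hρ.le).comp (continuous_const.sub continuous_id)).continuousOn
  have h2 : IntegrableOn u (Ioo 0 (T / 2)) := by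
    refine (h1.continuousOn_smul_of_subset hcont isCompact_Icc measurableSet_Ioo
      Ioo_subset_Icc_self).congr_fun (fun ξ hξ => ?_) measurableSet_Ioo
    have : 0 < T / 2 - ξ := sub_pos.2 hξ.2
    simp only
    rw [smul_smul, ← Real.rpow_add this]
    ring_nf
    simp
  have h3 : IntegrableOn u (Icc (T / 2) T) :=
    (hu.continuousOn.mono fun t ht => ⟨hT2.trans_le ht.1, ht.2⟩).integrableOn_Icc
  have h4 : IntegrableOn u (Ioo 0 T) := by
    refine (h2.union h3).mono_set fun t ht => ?_
    rcases lt_or_ge t (T / 2) with h | h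
    · exact Or.inl ⟨ht.1, h⟩
    · exact Or.inr ⟨h, ht.2.le⟩
  exact c.integrable_comp h4

variable [CompleteSpace H] [IsScalarTower ℝ 𝕜 H]

/-- The expansion coefficients of a solution of the forward problem. -/
theorem IsForwardSolution.ae_inner_eq (hA : IsPositiveDiscrete A v lam)
    (hu : IsForwardSolution A ρ T f φ u) (hρ : 0 < ρ) (hρ1 : ρ < 1) (hT : 0 < T)
    (hfg : ∀ t ∈ Ioc 0 T, g t = t ^ (1 - ρ) • f t)
    (hg : IsContinuousInPowDomain v lam τ T g) (k : ℕ) :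
    ∀ᵐ t, t ∈ Ioo 0 T → inner 𝕜 (v k) (u t) = mlKernel ρ (lam k) ρ t • inner 𝕜 (v k) φ +
      halfConv (mlKernel ρ (lam k) ρ) (fun s => s ^ (ρ - 1) • inner 𝕜 (v k) (g s)) t := by
  set c : H →L[ℝ] 𝕜 := (innerSL 𝕜 (v k)).restrictScalars ℝ
  have hc : ∀ x, c x = inner 𝕜 (v k) x := fun x => rfl
  have hl := hA.lam_pos
  have hU := hu.integrableOn_inner hρ hT c
  have hF : IntegrableOn (fun s : ℝ => s ^ (ρ - 1) • inner 𝕜 (v k) (g s)) (Ioo 0 T) := by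
    have h1 : IntervalIntegrable (fun s : ℝ => s ^ (ρ - 1)) volume 0 T :=
      intervalIntegrable_rpow' (by linarith)
    rw [intervalIntegrable_iff_integrableOn_Ioo_of_le hT.le] at h1
    exact h1.smul_continuousOn_of_subset (hg.continuousOn_inner hl k) measurableSet_Ioo
      isCompact_Icc Ioo_subset_Icc_self
  have hFf : ∀ t ∈ Ioc 0 T, t ^ (ρ - 1) • inner 𝕜 (v k) (g t) = c (f t) := by
    intro t ht
    rw [hfg t ht, ← hc, map_smul, smul_smul, ← Real.rpow_add ht.1]
    simp
  refine ae_eq_mlKernel_of_fractional (U := fun t => inner 𝕜 (v k) (u t)) hρ hρ1 (hl k).le hT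
    hU hF fun t ht => ?_
  have hJ : ∀ s ∈ Ioo 0 T, halfConv (powerKernel (1 - ρ)) (fun t => inner 𝕜 (v k) (u t)) s =
      c (fracIntegral (ρ - 1) u s) := by
    intro s hs
    unfold fracIntegral halfConv
    rw [map_smul, ← c.intervalIntegral_comp_comm (hu.integrable s hs)]
    have : ∫ ξ in (0 : ℝ)..s, powerKernel (1 - ρ) ξ • inner 𝕜 (v k) (u (s - ξ)) =
        ∫ ξ in (0 : ℝ)..s, powerKernel (1 - ρ) (s - ξ) • inner 𝕜 (v k) (u ξ) := by
      have := integral_comp_sub_left (a := 0) (b := s)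
        (fun ξ => powerKernel (1 - ρ) (s - ξ) • inner 𝕜 (v k) (u ξ)) s
      simpa using this
    rw [this, ← intervalIntegral.integral_smul]
    refine integral_congr fun ξ _ => ?_
    simp only [map_smul]
    rw [smul_smul, hc, powerKernel, show -(ρ - 1) = 1 - ρ by ring, div_eq_inv_mul]
  have hderiv : ∀ x ∈ Ioo 0 t, HasDerivAt (fun s => c (fracIntegral (ρ - 1) u s))
      (x ^ (ρ - 1) • inner 𝕜 (v k) (g x) - lam k • inner 𝕜 (v k) (u x)) x := by
    intro x hx
    have hx' : x ∈ Ioo 0 T := ⟨hx.1, hx.2.trans ht.2⟩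
    have h1 := c.hasFDerivAt.comp_hasDerivAt x (hu.differentiableAt x hx').hasDerivAt
    have h2 : deriv (fracIntegral (ρ - 1) u) x = f x - A ⟨u x, hu.mem_domain x hx'⟩ :=
      eq_sub_of_add_eq (hu.equation x hx')
    rw [h2, map_sub, hc (A _), hA.inner_apply k, ← hFf x ⟨hx'.1, hx'.2.le⟩] at h1
    rw [RCLike.real_smul_eq_coe_mul (lam k)]
    exact h1
  have hint : IntervalIntegrable (fun x : ℝ => x ^ (ρ - 1) • inner 𝕜 (v k) (g x) -
      lam k • inner 𝕜 (v k) (u x)) volume 0 t := by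
    rw [intervalIntegrable_iff_integrableOn_Ioo_of_le ht.1.le]
    exact (hF.sub (hU.smul (lam k))).mono_set (Ioo_subset_Ioo_right ht.2.le)
  -- The equation is integrated over (0, t); at the left end only the limit φ of the fractional
  -- integral is available.
  have key := integral_eq_sub_of_hasDerivAt_of_tendsto ht.1 hderiv hint
    ((c.continuous.tendsto φ).comp hu.initial)
    ((c.continuous.continuousAt.comp
      (hu.differentiableAt t ht).continuousAt).tendsto.mono_left nhdsWithin_le_nhds)
  rw [hJ t ht, key]
  simp [hc]

/-- Estimate of finitely many weighted coefficients of a solution at almost every time. -/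
theorem IsForwardSolution.ae_sum_le (hA : IsPositiveDiscrete A v lam)
    (hu : IsForwardSolution A ρ T f φ u) (hρ : 0 < ρ) (hρ1 : ρ < 1) (hT : 0 < T)
    (hfg : ∀ t ∈ Ioc 0 T, g t = t ^ (1 - ρ) • f t)
    (hg : IsContinuousInPowDomain v lam τ T g) {C D σ : ℝ} (hD : 0 < D) (hσ : 0 < σ)
    (hCb : ∀ k, ∀ t > 0, lam k ^ 2 * mlKernel ρ (lam k) ρ t ≤ C * t ^ (-1 - ρ))
    (hDb : ∀ k, ∀ t > 0,
      lam k ^ 2 * mlKernel ρ (lam k) ρ t ≤ D * lam k ^ τ * t ^ (σ - 1))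
    (S : Finset ℕ) :
    ∀ᵐ t, t ∈ Ioo 0 T → ∑ k ∈ S, (lam k ^ 2 * ‖inner 𝕜 (v k) (u t)‖) ^ 2 ≤
      2 * (C * t ^ (-1 - ρ) * ‖φ‖) ^ 2 + 2 * (maxPowNorm v lam τ T g *
        (D * Real.Gamma σ * Real.Gamma ρ * powerKernel (σ + ρ) t)) ^ 2 := by
  have hl := hA.lam_pos
  filter_upwards [ae_all_iff.2 fun k => hu.ae_inner_eq hA hρ hρ1 hT hfg hg k] with t h ht
  have ht0 : 0 < t := ht.1
  have hGσ := Real.Gamma_pos_of_pos hσ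
  have hGρ := Real.Gamma_pos_of_pos hρ
  set M := maxPowNorm v lam τ T g
  have hM : 0 ≤ M :=
    (powNorm_nonneg _).trans (hg.powNorm_le hl (left_mem_Icc.2 hT.le))
  -- This equals D s^(σ-1) (t-s)^(ρ-1), normalised so that its integral follows from the semigroup
  -- law.
  set w : ℝ → ℝ := fun s =>
    D * Real.Gamma σ * Real.Gamma ρ * (powerKernel σ s * powerKernel ρ (t - s))
  set a : ℕ → ℝ → ℝ := fun k s => lam k ^ τ * ‖inner 𝕜 (v k) (g (t - s))‖
  have hwi : IntegrableOn w (Ioo 0 t) :=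
    ((intervalIntegrable_iff_integrableOn_Ioo_of_le ht0.le).1
      (intervalIntegrable_powerKernel_mul hσ hρ ht0)).const_mul _
  have hwint : ∫ s in Ioo 0 t, w s =
      D * Real.Gamma σ * Real.Gamma ρ * powerKernel (σ + ρ) t := by
    rw [MeasureTheory.integral_const_mul, ← integral_Ioc_eq_integral_Ioo, ← integral_of_le ht0.le,
      integral_powerKernel_mul hσ hρ ht0]
  have hw0 : ∀ s ∈ Ioo 0 t, 0 ≤ w s := fun s hs => by
    have := powerKernel_nonneg hσ hs.1.le
    have := powerKernel_nonneg hρ (sub_nonneg.2 hs.2.le)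
    positivity
  have hmem : ∀ s ∈ Icc 0 t, t - s ∈ Icc 0 T := fun s hs =>
    ⟨by linarith [hs.2], by linarith [hs.1, ht.2]⟩
  have hac : ∀ k, ContinuousOn (a k) (Icc 0 t) := fun k =>
    continuousOn_const.mul (((hg.continuousOn_inner hl k).comp (by fun_prop) hmem).norm)
  have hwa : ∀ k, IntegrableOn (fun s => w s * a k s) (Ioo 0 t) := fun k =>
    hwi.smul_continuousOn_of_subset (hac k) measurableSet_Ioo isCompact_Icc Ioo_subset_Icc_self
  -- The decay bound serves the initial datum; the interpolated bound serves the source, moving the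
  -- weight l^τ onto g.
  have hterm : ∀ k, lam k ^ 2 * ‖inner 𝕜 (v k) (u t)‖ ≤
      C * t ^ (-1 - ρ) * ‖inner 𝕜 (v k) φ‖ + ∫ s in Ioo 0 t, w s * a k s := by
    intro k
    have hk := hl k
    have he : ∀ s > 0, 0 ≤ mlKernel ρ (lam k) ρ s := fun s hs =>
      (mlKernel_pos hρ hρ1.le hk.le hs).le
    rw [h k ht]
    have h1 : ‖mlKernel ρ (lam k) ρ t • inner 𝕜 (v k) φ‖ =
        mlKernel ρ (lam k) ρ t * ‖inner 𝕜 (v k) φ‖ := by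
      rw [norm_smul, Real.norm_of_nonneg (he t ht0)]
    have h2 : lam k ^ 2 * ‖halfConv (mlKernel ρ (lam k) ρ)
        (fun s => s ^ (ρ - 1) • inner 𝕜 (v k) (g s)) t‖ ≤ ∫ s in Ioo 0 t, w s * a k s := by
      have hnorm : ‖lam k ^ 2 • halfConv (mlKernel ρ (lam k) ρ)
          (fun s => s ^ (ρ - 1) • inner 𝕜 (v k) (g s)) t‖ = lam k ^ 2 *
          ‖halfConv (mlKernel ρ (lam k) ρ) (fun s => s ^ (ρ - 1) • inner 𝕜 (v k) (g s)) t‖ := by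
        rw [norm_smul, Real.norm_of_nonneg (by positivity)]
      rw [← hnorm]
      unfold halfConv
      rw [integral_of_le ht0.le, integral_Ioc_eq_integral_Ioo, ← MeasureTheory.integral_smul]
      refine norm_integral_le_of_norm_le (hwa k)
        ((ae_restrict_iff' measurableSet_Ioo).2 (ae_of_all _ fun s hs => ?_))
      have hts : 0 < t - s := sub_pos.2 hs.2
      rw [norm_smul, norm_smul, norm_smul, Real.norm_of_nonneg (he s hs.1),
        Real.norm_of_nonneg (by positivity : (0 : ℝ) ≤ lam k ^ 2),
        Real.norm_of_nonneg (by positivity : 0 ≤ (t - s) ^ (ρ - 1)), ← mul_assoc]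
      calc lam k ^ 2 * mlKernel ρ (lam k) ρ s * ((t - s) ^ (ρ - 1) * ‖inner 𝕜 (v k) (g (t - s))‖)
          ≤ (D * lam k ^ τ * s ^ (σ - 1)) *
            ((t - s) ^ (ρ - 1) * ‖inner 𝕜 (v k) (g (t - s))‖) :=
            mul_le_mul_of_nonneg_right (hDb k s hs.1) (by positivity)
        _ = w s * a k s := by
            simp only [w, a, powerKernel]
            field_simp
    calc lam k ^ 2 * ‖mlKernel ρ (lam k) ρ t • inner 𝕜 (v k) φ + halfConv (mlKernel ρ (lam k) ρ)
          (fun s => s ^ (ρ - 1) • inner 𝕜 (v k) (g s)) t‖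
        ≤ lam k ^ 2 * (‖mlKernel ρ (lam k) ρ t • inner 𝕜 (v k) φ‖ + ‖halfConv
          (mlKernel ρ (lam k) ρ) (fun s => s ^ (ρ - 1) • inner 𝕜 (v k) (g s)) t‖) := by
          gcongr; exact norm_add_le _ _
      _ ≤ _ := by
          rw [h1, mul_add, ← mul_assoc]
          exact add_le_add (mul_le_mul_of_nonneg_right (hCb k t ht0) (norm_nonneg _)) h2
  have hmink := sum_sq_integral_le (ν := volume.restrict (Ioo 0 t)) S (w := w) (a := a) hM hwi
    (fun k _ => hwa k) ((ae_restrict_iff' measurableSet_Ioo).2 (ae_of_all _ hw0))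
    ((ae_restrict_iff' measurableSet_Ioo).2 (ae_of_all _ fun s hs => by
      have hm := hmem s (Ioo_subset_Icc_self hs)
      have h1 := sum_le_powNorm_sq hl (hg.mem _ hm) S
      have h2 : powNorm v lam τ (g (t - s)) ^ 2 ≤ M ^ 2 :=
        pow_le_pow_left₀ (powNorm_nonneg _) (hg.powNorm_le hl hm) 2
      refine le_trans (le_of_eq (Finset.sum_congr rfl fun k _ => ?_)) (h1.trans h2)
      simp only [a]
      rw [mul_pow, mul_comm 2 τ, Real.rpow_mul (hl k).le,
        show (2 : ℝ) = ((2 : ℕ) : ℝ) by norm_num, Real.rpow_natCast]))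
  rw [hwint] at hmink
  have hbessel : ∑ k ∈ S, (C * t ^ (-1 - ρ) * ‖inner 𝕜 (v k) φ‖) ^ 2 ≤
      (C * t ^ (-1 - ρ) * ‖φ‖) ^ 2 := by
    have : ∀ k, (C * t ^ (-1 - ρ) * ‖inner 𝕜 (v k) φ‖) ^ 2 =
        (C * t ^ (-1 - ρ)) ^ 2 * ‖inner 𝕜 (v k) φ‖ ^ 2 := fun k => mul_pow _ _ _
    simp_rw [this]
    rw [← Finset.mul_sum, mul_pow (C * t ^ (-1 - ρ))]
    exact mul_le_mul_of_nonneg_left (v.orthonormal.sum_inner_products_le φ) (sq_nonneg _)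
  calc ∑ k ∈ S, (lam k ^ 2 * ‖inner 𝕜 (v k) (u t)‖) ^ 2
      ≤ ∑ k ∈ S, (2 * (C * t ^ (-1 - ρ) * ‖inner 𝕜 (v k) φ‖) ^ 2 +
          2 * (∫ s in Ioo 0 t, w s * a k s) ^ 2) := by
        refine Finset.sum_le_sum fun k _ => ?_
        have hk := hl k
        refine (pow_le_pow_left₀ (by positivity) (hterm k) 2).trans ?_
        nlinarith [sq_nonneg (C * t ^ (-1 - ρ) * ‖inner 𝕜 (v k) φ‖ -
          ∫ s in Ioo 0 t, w s * a k s)]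
    _ = 2 * ∑ k ∈ S, (C * t ^ (-1 - ρ) * ‖inner 𝕜 (v k) φ‖) ^ 2 +
          2 * ∑ k ∈ S, (∫ s in Ioo 0 t, w s * a k s) ^ 2 := by
        rw [Finset.sum_add_distrib, Finset.mul_sum, Finset.mul_sum]
    _ ≤ _ := by linarith

end components

/-! ### The estimate at time T -/

theorem corollary1 {𝕜 : Type*} [RCLike 𝕜] (ρ T ε μ : ℝ)
    (hρ₀ : 0 < ρ) (hρ₁ : ρ < 1) (hT : 0 < T) (hε : 0 < ε) (hμ : 0 < μ) :
    ∃ C : ℝ, ∀ (H : Type*) [NormedAddCommGroup H] [InnerProductSpace 𝕜 H] [CompleteSpace H]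
      [NormedSpace ℝ H] [IsScalarTower ℝ 𝕜 H]
      (A : H →ₗ.[𝕜] H) (v : HilbertBasis ℕ 𝕜 H) (lam : ℕ → ℝ),
      IsPositiveDiscrete A v lam →
      (ε < 1 ∨ μ ≤ lam 0) →
      ∀ (φ : H) (f g u : ℝ → H),
        (∀ t ∈ Set.Ioc 0 T, g t = t ^ (1 - ρ) • f t) →
        IsContinuousInPowDomain v lam (1 + ε) T g →
        IsForwardSolution A ρ T f φ u →
        u T ∈ powDomain v lam 2 ∧
          powNorm v lam 2 (u T) ≤ C * (‖φ‖ + maxPowNorm v lam (1 + ε) T g) := by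
  obtain ⟨C, hC, hCb⟩ := exists_mlKernel_le hρ₀ hρ₁
  obtain ⟨D, hD, hDb⟩ := exists_sq_mul_mlKernel_le hρ₀ hρ₁ hε hμ
  set σ := ρ * min ε 1
  have hσ : 0 < σ := mul_pos hρ₀ (lt_min hε one_pos)
  have hGσ := Real.Gamma_pos_of_pos hσ
  have hGρ := Real.Gamma_pos_of_pos hρ₀
  set c₁ := C * T ^ (-1 - ρ)
  set c₂ := D * Real.Gamma σ * Real.Gamma ρ * powerKernel (σ + ρ) T
  have hc₁ : 0 < c₁ := by positivity
  have hc₂ : 0 < c₂ := by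
    have := powerKernel_pos (add_pos hσ hρ₀) hT
    positivity
  refine ⟨2 * (c₁ + c₂), fun H _ _ _ _ _ A v lam hA hor φ f g u hfg hg hu => ?_⟩
  have hl := hA.lam_pos
  set M := maxPowNorm v lam (1 + ε) T g
  have hM : 0 ≤ M := (powNorm_nonneg _).trans (hg.powNorm_le hl (left_mem_Icc.2 hT.le))
  -- Partial sums suffice, and finiteness of S makes both sides continuous on (0, T], as the passage
  -- from almost every t to T requires.
  have hsum : ∀ S : Finset ℕ, ∑ k ∈ S, lam k ^ (2 * (2 : ℝ)) * ‖inner 𝕜 (v k) (u T)‖ ^ 2 ≤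
      (2 * (c₁ + c₂) * (‖φ‖ + M)) ^ 2 := by
    intro S
    have hae := hu.ae_sum_le hA hρ₀ hρ₁ hT hfg hg hD hσ
      (fun k t ht => by
        have hk := hl k
        have := mul_le_mul_of_nonneg_left (hCb (lam k) hk t ht).2 (sq_nonneg (lam k))
        refine this.trans_eq ?_
        field_simp)
      -- Monotonicity carries μ ≤ lam 0 to every eigenvalue. For ε < 1 no relation with μ is
      -- required, so μ may be any fixed positive number, such as 1.
      (fun k t ht => hDb (lam k) (hl k)
        (hor.imp_right fun h => h.trans (hA.mono (Nat.zero_le k))) t ht) S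
    have hcont : ContinuousOn
        (fun t => ∑ k ∈ S, (lam k ^ 2 * ‖inner 𝕜 (v k) (u t)‖) ^ 2) (Ioc 0 T) := by
      refine continuousOn_finsetSum S fun k _ => ?_
      exact (continuousOn_const.mul ((continuousOn_const.inner hu.continuousOn).norm)).pow 2
    have hcont' : ContinuousOn (fun t => 2 * (C * t ^ (-1 - ρ) * ‖φ‖) ^ 2 + 2 * (M *
        (D * Real.Gamma σ * Real.Gamma ρ * powerKernel (σ + ρ) t)) ^ 2) (Ioc 0 T) := by
      have h1 : ContinuousOn (fun t : ℝ => t ^ (-1 - ρ)) (Ioc 0 T) := fun t ht =>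
        (Real.continuousAt_rpow_const _ _ (Or.inl ht.1.ne')).continuousWithinAt
      have h2 : ContinuousOn (powerKernel (σ + ρ)) (Ioc 0 T) :=
        continuousOn_powerKernel.mono fun t ht => ht.1
      fun_prop
    have hfin := le_of_ae_le_of_continuousOn_Ioc hT hcont hcont' hae
    calc ∑ k ∈ S, lam k ^ (2 * (2 : ℝ)) * ‖inner 𝕜 (v k) (u T)‖ ^ 2
        = ∑ k ∈ S, (lam k ^ 2 * ‖inner 𝕜 (v k) (u T)‖) ^ 2 := by
          refine Finset.sum_congr rfl fun k _ => ?_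
          rw [mul_pow, ← pow_mul, show (2 * (2 : ℝ)) = ((2 * 2 : ℕ) : ℝ) by norm_num,
            Real.rpow_natCast]
      _ ≤ 2 * (c₁ * ‖φ‖) ^ 2 + 2 * (M * c₂) ^ 2 := hfin
      _ ≤ (2 * (c₁ * ‖φ‖ + M * c₂)) ^ 2 := by
          have : 0 ≤ c₁ * ‖φ‖ * (M * c₂) := by positivity
          nlinarith [sq_nonneg (c₁ * ‖φ‖), sq_nonneg (M * c₂)]
      _ ≤ _ := by
          refine pow_le_pow_left₀ (by positivity) ?_ 2
          have : 0 ≤ c₁ * M := by positivity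
          have : 0 ≤ c₂ * ‖φ‖ := by positivity
          nlinarith
  have hnn : ∀ k, 0 ≤ lam k ^ (2 * (2 : ℝ)) * ‖inner 𝕜 (v k) (u T)‖ ^ 2 := fun k => by
    have := hl k; positivity
  refine ⟨summable_of_sum_le hnn hsum, Real.sqrt_le_iff.2 ⟨by positivity, ?_⟩⟩
  exact Real.tsum_le_of_sum_le hnn hsum
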